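/- Let $\mathbb K=\mathbb R$ or $\mathbb C$, let $V,H$ be separable Hilbert spaces over $\mathbb K$ with $V$ continuously and densely embedded in $H$, and let $V'$ be the antidual of $V$ (the dual if $\mathbb K=\mathbb R$). Identify $h\in H$ with the functional $v\mapsto (h\mid v)_H$ in $V'$, so that $V\subset H\subset V'$. Let $0<T<\infty$ and let $\mathfrak a,\mathfrak b\colon[0,T]\times V\times V\to\mathbb K$ be such that, for $\mathfrak c\in\{\mathfrak a,\mathfrak b\}$: * $\mathfrak c(t,\cdot,\cdot)$ is sesquilinear for every $t\in[0,T]$, and $\mathfrak c(\cdot,u,v)$ is measurable for all $u,v\in V$; * ($V$-boundedness) there is a constant $M$ with $|\mathfrak c(t,u,v)|\le M\|u\|_V\|v\|_V$ for all $t\in[0,T]$, $u,v\in V$; * (quasi-coercivity) there are constants $\alpha>0$, $\omega\in\mathbb R$ with $\operatorname{Re}\mathfrak c(t,u,u)+\omega\|u\|_H^2\ge\alpha\|u\|_V^2$ for all $t\in[0,T]$, $u\in V$. Let $\mathcal A(t),\mathcal B(t)\in\mathcal L(V,V')$ be the associated operators, $\langle\mathcal A(t)u,v\rangle=\mathfrak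 a(t,u,v)$ and $\langle\mathcal B(t)u,v\rangle=\mathfrak b(t,u,v)$. Put $MR(V,V,V')=H^1(0,T;V)\cap H^2(0,T;V')$, with norm $\|u\|_{MR(V,V,V')}=\|u\|_{H^1(0,T;V)}+\|u\|_{H^2(0,T;V')}$. Then for every $u_0\in V$, $u_1\in H$ and $f\in L^2(0,T;V')$ there exists a unique $u\in MR(V,V,V')$ such that $$\ddot u(t)+\mathcal B(t)\dot u(t)+\mathcal A(t)u(t)=f(t)\ \text{ in } V' \text{ for a.e. } t\in(0,T),\qquad u(0)=u_0,\quad \dot u(0)=u_1,$$ where $\dot u,\ddot u$ are weak derivatives and the initial conditions mean that $u$ has a representative in $C([0,T];V)$ with value $u_0$ at $0$, and $\dot u$ has a representative in $C([0,T];H)$ with value $u_1$ at $0$. Moreover, there is a constant $C>0$, independent of $u_0,u_1,f$, such that this solution satisfies $$\|u\|_{MR(V,V,V')}\le C\left[\|u_0\|_V+\|u_1\|_H+\|f\|_{L^2(0,T;V')}\right].$$ -/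

import Mathlib

open MeasureTheory Set
open scoped ContDiff

noncomputable section

namespace DampedWave

/-! ### Vector-valued Lebesgue and Sobolev spaces on `(0,T)` -/

/-- Lebesgue measure on the interval `(0,T)`. -/
abbrev intervalMeasure (T : ℝ) : Measure ℝ := volume.restrict (Ioo 0 T)

/-- The space `L²(0,T;E)` of classes of functions modulo equality almost everywhere. -/
abbrev L2 (T : ℝ) (E : Type*) [NormedAddCommGroup E] := Lp E 2 (intervalMeasure T)

section WeakDerivative

variable {T : ℝ} {E : Type*} [NormedAddCommGroup E] [NormedSpace ℝ E]

/-- `g` is a weak derivative of `u` on `(0,T)`: `∫ φ' u = - ∫ φ g` for all `φ ∈ C_c^∞(0,T)`. -/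
def IsWeakDeriv (u g : L2 T E) : Prop :=
  ∀ φ : ℝ → ℝ, ContDiff ℝ ∞ φ → HasCompactSupport φ → tsupport φ ⊆ Ioo 0 T →
    ∫ t in Ioo 0 T, deriv φ t • u t = - ∫ t in Ioo 0 T, φ t • g t

/-- Weak derivatives are unique. -/
theorem IsWeakDeriv.unique [CompleteSpace E] {u g h : L2 T E}
    (hg : IsWeakDeriv u g) (hh : IsWeakDeriv u h) : g = h := by
  have key : ∀ k : L2 T E, IntegrableOn k (Ioo 0 T) volume := fun k =>
    (Lp.memLp k).integrable (by norm_num)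
  have hint : ∀ k : L2 T E, ∀ φ : ℝ → ℝ, ContDiff ℝ ∞ φ → HasCompactSupport φ →
      Integrable (fun t => φ t • k t) (volume.restrict (Ioo 0 T)) := by
    intro k φ hφ hc
    obtain ⟨C, hC⟩ := hφ.continuous.bounded_above_of_compact_support hc
    exact (key k).bdd_smul C hφ.continuous.aestronglyMeasurable (Filter.Eventually.of_forall hC)
  have h0 : ∀ᵐ t ∂volume, t ∈ Ioo 0 T → (g t - h t) = 0 := by
    apply isOpen_Ioo.ae_eq_zero_of_integral_contDiff_smul_eq_zero
    · exact (((key g).sub (key h)).locallyIntegrableOn)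
    · intro φ hφ hc hs
      have e1 : ∫ t, φ t • (g t - h t) = ∫ t in Ioo 0 T, φ t • (g t - h t) := by
        symm
        apply setIntegral_eq_integral_of_forall_compl_eq_zero
        intro t ht
        have : φ t = 0 := by
          by_contra hne
          exact ht (hs (subset_tsupport φ hne))
        simp [this]
      rw [e1]
      simp only [smul_sub]
      rw [integral_sub (hint g φ hφ hc) (hint h φ hφ hc), sub_eq_zero]
      exact neg_injective ((hg φ hφ hc hs).symm.trans (hh φ hφ hc hs))
  apply Lp.ext
  filter_upwards [(ae_restrict_iff' measurableSet_Ioo).2 h0] with t ht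
  exact sub_eq_zero.1 ht

variable (T E) in
/-- The Sobolev space `H¹(0,T;E)`, as a subset of `L²(0,T;E)`. -/
def H1 : Set (L2 T E) := {u | ∃ g, IsWeakDeriv u g}

open Classical in
/-- The weak derivative of `u ∈ H¹(0,T;E)` (with value `0` if `u ∉ H¹(0,T;E)`). -/
def weakDeriv (u : L2 T E) : L2 T E :=
  if h : ∃ g, IsWeakDeriv u g then h.choose else 0

theorem isWeakDeriv_weakDeriv {u : L2 T E} (hu : u ∈ H1 T E) : IsWeakDeriv u (weakDeriv u) := by
  have h : ∃ g, IsWeakDeriv u g := hu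
  rw [weakDeriv, dif_pos h]
  exact h.choose_spec

theorem IsWeakDeriv.weakDeriv_eq [CompleteSpace E] {u g : L2 T E} (h : IsWeakDeriv u g) :
    weakDeriv u = g :=
  (isWeakDeriv_weakDeriv ⟨g, h⟩).unique h

variable (T E) in
/-- The Sobolev space `H²(0,T;E)`, as a subset of `L²(0,T;E)`. -/
def H2 : Set (L2 T E) := {u | u ∈ H1 T E ∧ weakDeriv u ∈ H1 T E}

/-- The norm of `H¹(0,T;E)`. -/
def normH1 (u : L2 T E) : ℝ := √(‖u‖ ^ 2 + ‖weakDeriv u‖ ^ 2)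

/-- The norm of `H²(0,T;E)`. -/
def normH2 (u : L2 T E) : ℝ := √(‖u‖ ^ 2 + ‖weakDeriv u‖ ^ 2 + ‖weakDeriv (weakDeriv u)‖ ^ 2)

end WeakDerivative

/-- `u` has a representative that is continuous on `[0,T]` and takes the value `x` at `0`. -/
def HasInitialValue {T : ℝ} {E : Type*} [NormedAddCommGroup E] (u : L2 T E) (x : E) : Prop :=
  ∃ v : ℝ → E, ContinuousOn v (Icc 0 T) ∧ u =ᵐ[intervalMeasure T] v ∧ v 0 = x

/-! ### The antidual and the embeddings `V ⊆ H ⊆ V'` -/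

/-- The antidual `V'` of `V`: continuous antilinear functionals (the dual if `𝕜 = ℝ`). -/
abbrev Antidual (𝕜 V : Type*) [RCLike 𝕜] [NormedAddCommGroup V] [NormedSpace 𝕜 V] :=
  V →L⋆[𝕜] 𝕜

section Forms

variable {𝕜 V H : Type*} [RCLike 𝕜]
  [NormedAddCommGroup V] [InnerProductSpace 𝕜 V]
  [NormedAddCommGroup H] [InnerProductSpace 𝕜 H]

/-- For `ι : V → H`, the map `H → V'` sending `h` to `v ↦ (h | v)_H`, where `(· | ·)_H` is linear
in the first argument (Mathlib's `inner` is linear in the second). -/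
def toAntidual (ι : V →L[𝕜] H) : H →L[𝕜] Antidual 𝕜 V :=
  LinearMap.mkContinuous
    { toFun := fun h => (innerSLFlip 𝕜 h).comp ι
      map_add' := fun x y => by ext v; simp
      map_smul' := fun c x => by ext v; simp } ‖ι‖ (fun h => by
    refine ContinuousLinearMap.opNorm_le_bound _ (by positivity) fun v => ?_
    calc ‖inner 𝕜 (ι v) h‖ ≤ ‖ι v‖ * ‖h‖ := norm_inner_le_norm _ _
      _ ≤ (‖ι‖ * ‖v‖) * ‖h‖ := by gcongr; exact ι.le_opNorm v
      _ = ‖ι‖ * ‖h‖ * ‖v‖ := by ring)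

theorem toAntidual_apply (ι : V →L[𝕜] H) (h : H) (v : V) :
    toAntidual ι h v = inner 𝕜 (ι v) h := rfl

/-- The embedding `V → V'` through `H`. -/
def embAntidual (ι : V →L[𝕜] H) : V →L[𝕜] Antidual 𝕜 V := (toAntidual ι).comp ι

/-! ### Non-autonomous forms -/

variable (𝕜 V) in
/-- A `V`-bounded non-autonomous sesquilinear form `a : [0,T] × V × V → 𝕜`, linear in the first
and antilinear in the second argument; `a(·,u,v)` is Lebesgue measurable on `[0,T]` for all
`u, v ∈ V`. The values for `t ∉ [0,T]` play no role. -/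
structure NonautonomousForm (T : ℝ) where
  /-- the underlying family of sesquilinear forms -/
  form : ℝ → V →ₗ[𝕜] V →ₗ⋆[𝕜] 𝕜
  bounded : ∃ M : ℝ, ∀ t ∈ Icc 0 T, ∀ u v : V, ‖form t u v‖ ≤ M * ‖u‖ * ‖v‖
  measurable : ∀ u v : V, AEMeasurable (fun t => form t u v) (volume.restrict (Icc 0 T))

/-- Quasi-coercivity: `Re a(t,u,u) + w ‖u‖_H² ≥ α ‖u‖_V²` for some `α > 0` and `w ∈ ℝ`. -/
def NonautonomousForm.QuasiCoercive {T : ℝ} (a : NonautonomousForm 𝕜 V T) (ι : V →L[𝕜] H) : Prop :=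
  ∃ α : ℝ, 0 < α ∧ ∃ w : ℝ, ∀ t ∈ Icc 0 T, ∀ u : V,
    α * ‖u‖ ^ 2 ≤ RCLike.re (a.form t u u) + w * ‖ι u‖ ^ 2

/-- The operator `A(t) ∈ L(V,V')` associated with `a(t,·,·)`, that is `⟨A(t)u, v⟩ = a(t,u,v)`. -/
def NonautonomousForm.op {T : ℝ} (a : NonautonomousForm 𝕜 V T) (t : ℝ) (ht : t ∈ Icc 0 T) :
    V →L[𝕜] Antidual 𝕜 V :=
  LinearMap.mkContinuousOfExistsBound₂ (a.form t) (a.bounded.imp fun _ h => h t ht)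

theorem NonautonomousForm.op_apply {T : ℝ} (a : NonautonomousForm 𝕜 V T) (t : ℝ)
    (ht : t ∈ Icc 0 T) (u v : V) : a.op t ht u v = a.form t u v := rfl

/-! ### The maximal regularity space and the Cauchy problem -/

variable [NormedSpace ℝ V]

/-- `MR(V,V,V') = H¹(0,T;V) ∩ H²(0,T;V')`. -/
def MR (T : ℝ) (ι : V →L[𝕜] H) : Set (L2 T V) :=
  {u | u ∈ H1 T V ∧ (embAntidual ι).compLp u ∈ H2 T (Antidual 𝕜 V)}

/-- The norm of `MR(V,V,V')`, as an intersection of two normed spaces. -/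
def normMR {T : ℝ} (ι : V →L[𝕜] H) (u : L2 T V) : ℝ :=
  normH1 u + normH2 ((embAntidual ι).compLp u)

/-- `u ∈ MR(V,V,V')` solves `ü + B(t) u̇ + A(t) u = f` for almost every `t ∈ (0,T)`, as an equation
in `V'`, with `u(0) = u₀` (continuous representative in `V`) and `u̇(0) = u₁` (continuous
representative of `u̇` in `H`). -/
structure IsSolution {T : ℝ} (ι : V →L[𝕜] H) (a b : NonautonomousForm 𝕜 V T)
    (u₀ : V) (u₁ : H) (f : L2 T (Antidual 𝕜 V)) (u : L2 T V) : Prop where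
  mem : u ∈ MR T ι
  equation : ∀ᵐ t ∂intervalMeasure T, ∀ ht : t ∈ Icc 0 T,
    weakDeriv (weakDeriv ((embAntidual ι).compLp u)) t
      + b.op t ht (weakDeriv u t) + a.op t ht (u t) = f t
  initial : HasInitialValue u u₀
  initial_deriv : HasInitialValue (ι.compLp (weakDeriv u)) u₁

end Forms

end DampedWave

end

/-!
The equation is read as a first-order problem for `w = u̇`: with `u = u₀ + ∫₀ᵗ w` it becomes
`ẇ + B w + A ∫₀ᵗ w = f - A u₀`, `w(0) = u₁`, a parabolic problem for the form `b` with a memory term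
of Volterra type.

*Existence* follows J.-L. Lions. On test functions `φ ∈ C¹([0,T];V)` with `φ(T) = 0` the formal
adjoint `S` of the left-hand side takes values in the Hilbert space `L²(0,T;V)`. Tested against
`exp (2 r t) φ(t)`, it controls `φ` in `L²(0,T;V)` and `φ(0)` in `H` once `r` is large: the weight
absorbs the lower-order term of quasi-coercivity, and makes the memory term, which the boundedness
of `a` controls, small by the Cauchy–Schwarz inequality (`exists_norm_le_adjointOp`). Hence the
functional given by `f - A u₀` and `u₁` factors through `S` and is represented by some
`w ∈ L²(0,T;V)` (`exists_inner_eq_of_norm_le`).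

*Traces and energy.* A function `w ∈ L²(0,T;V)` with weak derivative `g ∈ L²(0,T;V')` has a
representative in `C([0,T];H)` and satisfies `‖w(t)‖_H² = ‖w(0)‖_H² + 2 Re ∫₀ᵗ ⟨g, w⟩`
(`exists_continuousOn_representative`). It is proved by regularisation: averages against smooth
kernels, centred so that they only see values inside `(0,T)`, commute with weak derivatives up to a
factor and converge in `L²` (`exists_contDiff_approx`), and the classical energy identity makes
them a Cauchy sequence in `C([0,T];H)`.

*Uniqueness and the estimate* follow from the energy identity and Gronwall's inequality
(`exists_norm_weakDeriv_sq_le`, `exists_normMR_le`), since the difference of two solutions solves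
the problem with zero data.
-/

noncomputable section

open MeasureTheory Set Filter Topology
open scoped ContDiff ENNReal Convolution

namespace DampedWave

/-! ### Regularisation by averages that stay inside the interval -/

section Mollifier

theorem integrableOn_of_memLp_two {E : Type*} [NormedAddCommGroup E] {T : ℝ} {u : ℝ → E}
    (hu : MemLp u 2 (intervalMeasure T)) : IntegrableOn u (Ioo 0 T) := hu.integrable (by norm_num)

variable {E F : Type*} [NormedAddCommGroup E] [NormedSpace ℝ E]
  [NormedAddCommGroup F] [NormedSpace ℝ F]

/-- The average of `u` against the kernel `k`, centred at `(1 - ε) t + ε T / 2`. If `k` is supported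
in a ball of radius less than `ε T / 2`, then for `t ∈ [0,T]` only values of `u` in a compact subset
of `(0,T)` enter, so that no extension of `u` beyond the interval is needed. -/
def mollify (T ε : ℝ) (k : ℝ → ℝ) (u : ℝ → E) (t : ℝ) : E :=
  ∫ s in Ioo 0 T, k ((1 - ε) * t + ε * T / 2 - s) • u s

variable {T ε : ℝ} {k : ℝ → ℝ}

theorem mollify_eq_convolution (u : ℝ → E) (t : ℝ) :
    mollify T ε k u t = (k ⋆[ContinuousLinearMap.lsmul ℝ ℝ, volume] (Ioo 0 T).indicator u)
      ((1 - ε) * t + ε * T / 2) := by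
  rw [convolution_lsmul_swap, mollify, ← integral_indicator measurableSet_Ioo]
  congr 1
  ext s
  by_cases hs : s ∈ Ioo 0 T <;> simp [hs]

theorem hasDerivAt_mollify (hk : ContDiff ℝ 1 k) (hc : HasCompactSupport k) {u : ℝ → E}
    (hu : IntegrableOn u (Ioo 0 T)) (t : ℝ) :
    HasDerivAt (mollify T ε k u) ((1 - ε) • mollify T ε (deriv k) u t) t := by
  have h1 : LocallyIntegrable ((Ioo 0 T).indicator u) volume :=
    ((integrable_indicator_iff measurableSet_Ioo).2 hu).locallyIntegrable
  have h2 := hc.hasDerivAt_convolution_left (ContinuousLinearMap.lsmul ℝ ℝ) (μ := volume) hk h1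
    ((1 - ε) * t + ε * T / 2)
  have h3 : HasDerivAt (fun t : ℝ => (1 - ε) * t + ε * T / 2) (1 - ε) t := by
    simpa using ((hasDerivAt_id t).const_mul (1 - ε)).add_const (ε * T / 2)
  have h4 := h2.scomp t h3
  rw [mollify_eq_convolution]
  refine h4.congr_of_eventuallyEq (Eventually.of_forall fun x => mollify_eq_convolution u x)

theorem contDiff_mollify (hk : ContDiff ℝ 1 k) (hc : HasCompactSupport k) {u : ℝ → E}
    (hu : IntegrableOn u (Ioo 0 T)) : ContDiff ℝ 1 (mollify T ε k u) := by
  have h1 : LocallyIntegrable ((Ioo 0 T).indicator u) volume :=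
    ((integrable_indicator_iff measurableSet_Ioo).2 hu).locallyIntegrable
  have h2 : ContDiff ℝ ((1 : ℕ∞) : WithTop ℕ∞)
      (k ⋆[ContinuousLinearMap.lsmul ℝ ℝ, volume] (Ioo 0 T).indicator u) :=
    hc.contDiff_convolution_left (n := 1) (ContinuousLinearMap.lsmul ℝ ℝ) (by exact_mod_cast hk) h1
  have h3 : ContDiff ℝ 1 (fun t : ℝ => (1 - ε) * t + ε * T / 2) := by fun_prop
  have h4 : ContDiff ℝ 1 ((k ⋆[ContinuousLinearMap.lsmul ℝ ℝ, volume] (Ioo 0 T).indicator u) ∘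
    (fun t : ℝ => (1 - ε) * t + ε * T / 2)) := by
    exact (show ContDiff ℝ 1 _ by exact_mod_cast h2).comp h3
  convert h4 using 1
  ext t
  exact mollify_eq_convolution u t

theorem integrable_kernel_smul (hk : Continuous k) (hc : HasCompactSupport k) {u : ℝ → E}
    (hu : IntegrableOn u (Ioo 0 T)) (a : ℝ) :
    Integrable (fun s => k (a - s) • u s) (volume.restrict (Ioo 0 T)) := by
  obtain ⟨C, hC⟩ := hk.bounded_above_of_compact_support hc
  exact Integrable.bdd_smul hu C
    (by fun_prop : Continuous fun s => k (a - s)).aestronglyMeasurable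
    (Eventually.of_forall fun s => hC _)

/-- Mollification turns weak derivatives into classical ones: the derivative falls on the kernel,
which for `t ∈ [0,T]` is an admissible test function. -/
theorem map_mollify_deriv {𝕜 : Type*} [RCLike 𝕜] [NormedSpace 𝕜 E] [NormedSpace 𝕜 F]
    [CompleteSpace E] [CompleteSpace F] (A : E →L[𝕜] F) {w : ℝ → E} {g : ℝ → F}
    (hw : IntegrableOn w (Ioo 0 T)) (hε1 : ε < 1)
    (hwg : ∀ φ : ℝ → ℝ, ContDiff ℝ ∞ φ → HasCompactSupport φ → tsupport φ ⊆ Ioo 0 T →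
      ∫ t in Ioo 0 T, deriv φ t • A (w t) = - ∫ t in Ioo 0 T, φ t • g t)
    (hk : ContDiff ℝ ∞ k) {r : ℝ} (hr : r < ε * T / 2)
    (hsupp : tsupport k ⊆ Metric.closedBall 0 r) {t : ℝ} (ht : t ∈ Icc 0 T) :
    A (mollify T ε (deriv k) w t) = mollify T ε k g t := by
  have hc : HasCompactSupport k := (isCompact_closedBall 0 r).of_isClosed_subset
    (isClosed_tsupport k) hsupp
  set a := (1 - ε) * t + ε * T / 2 with ha
  have hk' : ContDiff ℝ 1 k := hk.of_le (by exact_mod_cast le_top)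
  have h1 := hwg (fun s => k (a - s)) (hk.comp (by fun_prop))
    (hc.comp_homeomorph (Homeomorph.subLeft a)) (by
      have : tsupport (fun s => k (a - s)) = (Homeomorph.subLeft a) ⁻¹' tsupport k :=
        tsupport_comp_eq_preimage k (Homeomorph.subLeft a)
      rw [this]
      intro s hs
      have h2 := hsupp hs
      simp only [Homeomorph.subLeft_apply, Metric.mem_closedBall, dist_zero_right,
        Real.norm_eq_abs, abs_le] at h2
      have h3 : 0 ≤ (1 - ε) * t := mul_nonneg (by linarith) ht.1
      have h4 : (1 - ε) * t ≤ (1 - ε) * T := mul_le_mul_of_nonneg_left ht.2 (by linarith)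
      constructor <;> nlinarith [h2.1, h2.2])
  have h2 : ∀ s, deriv (fun s => k (a - s)) s = - deriv k (a - s) := fun s => by
    rw [deriv_comp_const_sub]
  simp only [h2, neg_smul, integral_neg, neg_inj] at h1
  rw [mollify, mollify, ← ha, ← h1, ← A.integral_comp_comm
    (integrable_kernel_smul (hk'.continuous_deriv le_rfl) hc.deriv hw a)]
  congr 1
  ext s
  exact map_real_smul A A.continuous _ _

/-- Schur's test for the mollification kernel: it is bounded on `L²(0,T;E)`. -/
theorem eLpNorm_mollify_le (hε : ε ≤ 1 / 2) (hk : Continuous k) (hc : HasCompactSupport k)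
    (hk0 : ∀ x, 0 ≤ k x) (hk1 : ∫ x, k x = 1) {u : ℝ → E}
    (hu : AEStronglyMeasurable u (intervalMeasure T)) :
    eLpNorm (mollify T ε k u) 2 (intervalMeasure T) ≤ 2 * eLpNorm u 2 (intervalMeasure T) := by
  have hint : ∀ a b : ℝ, a ≠ 0 → ∫⁻ s, ENNReal.ofReal (k (a * s + b)) = ENNReal.ofReal |a⁻¹| := by
    intro a b ha
    rw [← ofReal_integral_eq_lintegral_ofReal]
    · congr 1
      rw [Measure.integral_comp_mul_left (fun x => k (x + b)), integral_add_right_eq_self k, hk1]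
      simp
    · have h1 : Integrable (fun x => k (x + b)) :=
        (hk.integrable_of_hasCompactSupport hc).comp_add_right b
      exact h1.comp_mul_left' ha
    · exact Eventually.of_forall fun s => hk0 _
  have hcs : ∀ t, ‖mollify T ε k u t‖ₑ ^ 2 ≤
      ∫⁻ s in Ioo 0 T, ENNReal.ofReal (k ((1 - ε) * t + ε * T / 2 - s)) * ‖u s‖ₑ ^ 2 := by
    intro t
    set K : ℝ → ℝ≥0∞ := fun s => ENNReal.ofReal (k ((1 - ε) * t + ε * T / 2 - s)) with hK
    have hKm : Measurable K := by
      have : Continuous fun s => k ((1 - ε) * t + ε * T / 2 - s) := by fun_prop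
      exact this.measurable.ennreal_ofReal
    have hK1 : ∫⁻ s in Ioo 0 T, K s ≤ 1 := by
      calc ∫⁻ s in Ioo 0 T, K s ≤ ∫⁻ s, K s := setLIntegral_le_lintegral _ _
        _ = 1 := by
          have := hint (-1) ((1 - ε) * t + ε * T / 2) (by norm_num)
          simp only [neg_mul, one_mul, neg_add_eq_sub] at this
          rw [hK, this]
          norm_num
    -- Splitting the kernel as `K = K^(1/2) * K^(1/2)` prepares for the Cauchy–Schwarz inequality.
    have h1 : ‖mollify T ε k u t‖ₑ ≤
        ∫⁻ s in Ioo 0 T, K s ^ (1 / 2 : ℝ) * (K s ^ (1 / 2 : ℝ) * ‖u s‖ₑ) := by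
      refine (enorm_integral_le_lintegral_enorm _).trans_eq ?_
      congr 1
      ext s
      rw [enorm_smul, ← mul_assoc, ← ENNReal.rpow_add_of_nonneg _ _ (by norm_num) (by norm_num)]
      norm_num
      rw [hK, Real.enorm_of_nonneg (hk0 _)]
    have h2 := ENNReal.lintegral_mul_le_Lp_mul_Lq (volume.restrict (Ioo 0 T))
      (Real.HolderConjugate.two_two) (f := fun s => K s ^ (1 / 2 : ℝ))
      (g := fun s => K s ^ (1 / 2 : ℝ) * ‖u s‖ₑ) (hKm.pow_const _).aemeasurable
      ((hKm.pow_const _).aemeasurable.mul hu.enorm)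
    have h3 : ∀ s, (K s ^ (1 / 2 : ℝ)) ^ (2 : ℝ) = K s := fun s => by
      rw [← ENNReal.rpow_mul]; norm_num
    simp only [Pi.mul_apply, ENNReal.mul_rpow_of_nonneg _ _ (by norm_num : (0:ℝ) ≤ 2), h3] at h2
    calc ‖mollify T ε k u t‖ₑ ^ 2
        ≤ (1 ^ (1 / 2 : ℝ) * (∫⁻ s in Ioo 0 T, K s * ‖u s‖ₑ ^ (2 : ℝ)) ^ (1 / 2 : ℝ)) ^ 2 := by
          refine pow_le_pow_left' (h1.trans (h2.trans ?_)) 2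
          gcongr
      _ = _ := by
          rw [ENNReal.one_rpow, one_mul, ← ENNReal.rpow_natCast, ← ENNReal.rpow_mul]
          norm_num [hK]
  have hsq : ∀ v : ℝ → E, eLpNorm v 2 (intervalMeasure T) ^ 2 = ∫⁻ s in Ioo 0 T, ‖v s‖ₑ ^ 2 := by
    intro v
    have := eLpNorm_nnreal_pow_eq_lintegral (μ := intervalMeasure T) (f := v) (p := 2) (by norm_num)
    simpa using this
  have hmain : eLpNorm (mollify T ε k u) 2 (intervalMeasure T) ^ 2 ≤
      (2 * eLpNorm u 2 (intervalMeasure T)) ^ 2 := by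
    rw [mul_pow, hsq, hsq]
    calc ∫⁻ t in Ioo 0 T, ‖mollify T ε k u t‖ₑ ^ 2
        ≤ ∫⁻ t in Ioo 0 T, ∫⁻ s in Ioo 0 T,
            ENNReal.ofReal (k ((1 - ε) * t + ε * T / 2 - s)) * ‖u s‖ₑ ^ 2 := lintegral_mono hcs
      _ = ∫⁻ s in Ioo 0 T, ∫⁻ t in Ioo 0 T,
            ENNReal.ofReal (k ((1 - ε) * t + ε * T / 2 - s)) * ‖u s‖ₑ ^ 2 := by
          apply lintegral_lintegral_swap
          refine AEMeasurable.mul (f := fun p : ℝ × ℝ => ENNReal.ofReal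
            (k ((1 - ε) * p.1 + ε * T / 2 - p.2))) (g := fun p : ℝ × ℝ => ‖u p.2‖ₑ ^ 2) ?_ ?_
          · have : Continuous fun p : ℝ × ℝ => k ((1 - ε) * p.1 + ε * T / 2 - p.2) := by fun_prop
            exact this.measurable.ennreal_ofReal.aemeasurable
          · exact (hu.enorm.comp_snd).pow_const 2
      _ ≤ ∫⁻ s in Ioo 0 T, 2 * ‖u s‖ₑ ^ 2 := by
          refine lintegral_mono fun s => ?_
          have h5 : Continuous fun t => k ((1 - ε) * t + ε * T / 2 - s) := by fun_prop
          rw [lintegral_mul_const _ h5.measurable.ennreal_ofReal]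
          gcongr
          refine (setLIntegral_le_lintegral _ _).trans ?_
          have := hint (1 - ε) (ε * T / 2 - s) (by linarith)
          simp only [← add_sub_assoc] at this
          rw [this, abs_of_pos (by simp; linarith), ← ENNReal.ofReal_ofNat 2]
          apply ENNReal.ofReal_le_ofReal
          rw [inv_le_comm₀ (by linarith) (by norm_num)]
          linarith
      _ = 2 * ∫⁻ s in Ioo 0 T, ‖u s‖ₑ ^ 2 := lintegral_const_mul' _ _ (by norm_num)
      _ ≤ _ := by gcongr; norm_num
  exact (ENNReal.pow_le_pow_left_iff (by norm_num)).1 hmain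

variable (T) in
/-- The mollification kernels, normalised bumps around `0` whose radius is of the order of the
parameter `ε = 1 / (n + 2)`. -/
def bump (hT : 0 < T) (n : ℕ) : ContDiffBump (0 : ℝ) where
  rIn := T / (8 * (n + 2))
  rOut := T / (4 * (n + 2))
  rIn_pos := by positivity
  rIn_lt_rOut := by gcongr; norm_num

variable (T) in
/-- The regularising operators on `L²(0,T;E)`. -/
def regularize (hT : 0 < T) (n : ℕ) : (ℝ → E) → ℝ → E :=
  mollify T (1 / (n + 2)) ((bump T hT n).normed volume)

theorem contDiff_regularize (hT : 0 < T) (n : ℕ) {u : ℝ → E}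
    (hu : IntegrableOn u (Ioo 0 T)) : ContDiff ℝ 1 (regularize T hT n u) :=
  contDiff_mollify (bump T hT n).contDiff_normed (bump T hT n).hasCompactSupport_normed hu

/-- If `v` oscillates by at most `η` on distances `T / (n + 2)`, then `v` is reproduced up to `2 η`:
one `η` for averaging over the support of the kernel, one for the shift of its centre. -/
theorem norm_regularize_sub_le [CompleteSpace E] (hT : 0 < T) (n : ℕ) {v : ℝ → E}
    (hv : Continuous v) {η : ℝ}
    (h : ∀ x y, dist x y ≤ T / (n + 2) → dist (v x) (v y) ≤ η) {t : ℝ} (ht : t ∈ Ioo 0 T) :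
    ‖regularize T hT n v t - v t‖ ≤ η + η := by
  obtain ⟨ht0, htT⟩ := ht
  set ε : ℝ := 1 / (n + 2) with hε
  have hn : (0 : ℝ) < n + 2 := by positivity
  have hε0 : 0 < ε := by positivity
  have hε1 : ε ≤ 1 / 2 := by
    rw [hε]; gcongr; linarith [(Nat.cast_nonneg n : (0 : ℝ) ≤ n)]
  have hεT : T / (n + 2) = ε * T := by rw [hε]; ring
  have hr : (bump T hT n).rOut = ε * T / 4 := by
    change T / (4 * (n + 2)) = _
    rw [hε]; field_simp
  set a := (1 - ε) * t + ε * T / 2 with ha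
  have h3 : 0 < (1 - ε) * t := mul_pos (by linarith) ht0
  have h4 : (1 - ε) * t < (1 - ε) * T := mul_lt_mul_of_pos_left htT (by linarith)
  have hpos : 0 < ε * T := by positivity
  have hball : ∀ x ∈ Metric.ball a (bump T hT n).rOut, x ∈ Ioo 0 T := by
    intro x hx
    rw [hr, Metric.mem_ball, Real.dist_eq, abs_lt] at hx
    constructor <;> nlinarith [hx.1, hx.2]
  have haI : a ∈ Ioo 0 T := hball a (Metric.mem_ball_self (bump T hT n).rOut_pos)
  have h5 := ContDiffBump.dist_normed_convolution_le (μ := volume) (φ := bump T hT n)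
    (g := (Ioo 0 T).indicator v) (x₀ := a) (ε := η)
    (hv.aestronglyMeasurable.indicator measurableSet_Ioo) (by
      intro x hx
      rw [indicator_of_mem (hball x hx), indicator_of_mem haI]
      apply h
      rw [hr, Metric.mem_ball] at hx
      linarith)
  rw [indicator_of_mem haI, ← mollify_eq_convolution v t] at h5
  rw [← dist_eq_norm]
  refine (dist_triangle _ (v a) _).trans (add_le_add h5 (h _ _ ?_))
  rw [hεT, Real.dist_eq, abs_le, ha]
  constructor <;> nlinarith

theorem eLpNorm_regularize_le (hT : 0 < T) (n : ℕ) {u : ℝ → E}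
    (hu : AEStronglyMeasurable u (intervalMeasure T)) :
    eLpNorm (regularize T hT n u) 2 (intervalMeasure T) ≤ 2 * eLpNorm u 2 (intervalMeasure T) :=
  eLpNorm_mollify_le (by gcongr; linarith [(Nat.cast_nonneg n : (0 : ℝ) ≤ n)])
    (bump T hT n).continuous_normed (bump T hT n).hasCompactSupport_normed
    (bump T hT n).nonneg_normed (bump T hT n).integral_normed hu

theorem memLp_regularize (hT : 0 < T) (n : ℕ) {u : ℝ → E}
    (hu : MemLp u 2 (intervalMeasure T)) : MemLp (regularize T hT n u) 2 (intervalMeasure T) :=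
  ⟨(contDiff_regularize hT n (integrableOn_of_memLp_two hu)).continuous.aestronglyMeasurable,
    (eLpNorm_regularize_le hT n hu.1).trans_lt (ENNReal.mul_lt_top (by norm_num) hu.2)⟩

theorem regularize_sub (hT : 0 < T) (n : ℕ) {u v : ℝ → E} (hu : IntegrableOn u (Ioo 0 T))
    (hv : IntegrableOn v (Ioo 0 T)) :
    regularize T hT n (u - v) = regularize T hT n u - regularize T hT n v := by
  ext t
  simp only [regularize, mollify, Pi.sub_apply, smul_sub]
  exact integral_sub
    (integrable_kernel_smul (bump T hT n).continuous_normed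
      (bump T hT n).hasCompactSupport_normed hu _)
    (integrable_kernel_smul (bump T hT n).continuous_normed
      (bump T hT n).hasCompactSupport_normed hv _)

/-- Regularisations converge in `L²(0,T;E)`: they are uniformly bounded operators that converge on
the dense set of continuous functions. -/
theorem tendsto_eLpNorm_regularize_sub [CompleteSpace E] (hT : 0 < T) {u : ℝ → E}
    (hu : MemLp u 2 (intervalMeasure T)) :
    Tendsto (fun n => eLpNorm (regularize T hT n u - u) 2 (intervalMeasure T)) atTop (𝓝 0) := by
  have hcont : ∀ v : ℝ → E, Continuous v → HasCompactSupport v →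
      Tendsto (fun n => eLpNorm (regularize T hT n v - v) 2 (intervalMeasure T)) atTop (𝓝 0) := by
    intro v hv hvc
    set c : ℝ≥0∞ := (intervalMeasure T univ) ^ (2 : ℝ≥0∞).toReal⁻¹ with hc
    have hcfin : c ≠ ⊤ := by
      rw [hc]
      exact ENNReal.rpow_ne_top_of_nonneg (by positivity) (measure_ne_top _ _)
    have hb : ∀ η : ℝ, 0 < η → ∀ᶠ n : ℕ in atTop,
        eLpNorm (regularize T hT n v - v) 2 (intervalMeasure T) ≤ c * ENNReal.ofReal (η + η) := by
      intro η hη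
      obtain ⟨δ, hδ, hvδ⟩ := Metric.uniformContinuous_iff.1
        (hvc.uniformContinuous_of_continuous hv) η hη
      have h1 : Tendsto (fun n : ℕ => T / ((n : ℝ) + 2)) atTop (𝓝 0) :=
        tendsto_const_nhds.div_atTop (tendsto_atTop_add_const_right _ _ tendsto_natCast_atTop_atTop)
      filter_upwards [h1.eventually_lt_const hδ] with n hn
      refine eLpNorm_le_of_ae_bound ?_
      filter_upwards [ae_restrict_mem measurableSet_Ioo] with t ht
      exact norm_regularize_sub_le hT n hv (fun x y hxy => (hvδ (hxy.trans_lt hn)).le) ht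
    have h0 : Tendsto (fun η : ℝ => c * ENNReal.ofReal (η + η)) (𝓝[>] 0) (𝓝 0) := by
      have : Tendsto (fun η : ℝ => c * ENNReal.ofReal (η + η)) (𝓝 0)
          (𝓝 (c * ENNReal.ofReal (0 + 0))) :=
        ENNReal.Tendsto.const_mul
          ((ENNReal.continuous_ofReal.comp (by fun_prop : Continuous fun η : ℝ => η + η)).tendsto 0)
          (Or.inr hcfin)
      simp only [add_zero, ENNReal.ofReal_zero, mul_zero] at this
      exact this.mono_left nhdsWithin_le_nhds
    rw [ENNReal.tendsto_nhds_zero]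
    intro δ hδ
    obtain ⟨η, hη1, hη2⟩ := ((h0.eventually_le_const hδ).and self_mem_nhdsWithin).exists
    filter_upwards [hb η hη2] with n hn
    exact hn.trans hη1
  rw [ENNReal.tendsto_nhds_zero]
  intro δ hδ
  obtain ⟨v, hvc, huv, hv, hvm⟩ := hu.exists_hasCompactSupport_eLpNorm_sub_le (by norm_num)
    (ε := δ / 4) (ENNReal.div_pos hδ.ne' (by norm_num)).ne'
  filter_upwards [(hcont v hv hvc).eventually_le_const
    (ENNReal.div_pos hδ.ne' (by norm_num : (4 : ℝ≥0∞) ≠ ⊤))] with n hn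
  have hreg : ∀ f : ℝ → E, MemLp f 2 (intervalMeasure T) →
      AEStronglyMeasurable (regularize T hT n f) (intervalMeasure T) := fun f hf =>
    (contDiff_regularize hT n (integrableOn_of_memLp_two hf)).continuous.aestronglyMeasurable
  have hsplit : regularize T hT n u - u =
      regularize T hT n (u - v) + ((regularize T hT n v - v) + (v - u)) := by
    rw [regularize_sub hT n (integrableOn_of_memLp_two hu) (integrableOn_of_memLp_two hvm)]
    abel
  rw [hsplit]
  calc _ ≤ eLpNorm (regularize T hT n (u - v)) 2 (intervalMeasure T) +
        (eLpNorm (regularize T hT n v - v) 2 (intervalMeasure T) +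
          eLpNorm (v - u) 2 (intervalMeasure T)) := by
        refine (eLpNorm_add_le (hreg _ (hu.sub hvm)) (((hreg v hvm).sub hvm.1).add
          (hvm.1.sub hu.1)) (by norm_num)).trans ?_
        gcongr
        exact eLpNorm_add_le ((hreg v hvm).sub hvm.1) (hvm.1.sub hu.1) (by norm_num)
    _ ≤ 2 * (δ / 4) + (δ / 4 + δ / 4) := by
        gcongr
        · exact (eLpNorm_regularize_le hT n (hu.sub hvm).1).trans (by gcongr)
        · rwa [eLpNorm_sub_comm]
    _ = δ := by
        rw [← two_mul, ← two_mul, ← mul_assoc]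
        norm_num
        rw [mul_comm, ENNReal.div_mul_cancel] <;> norm_num

/-- If `g` is the weak derivative of `A ∘ w`, then `w` is a limit in `L²(0,T;E)` of `C¹` functions
`zₙ` such that `A ∘ zₙ'` converges to `g` in `L²(0,T;F)`. -/
theorem exists_contDiff_approx {𝕜 : Type*} [RCLike 𝕜] [NormedSpace 𝕜 E] [NormedSpace 𝕜 F]
    [CompleteSpace E] [CompleteSpace F] (A : E →L[𝕜] F) (hT : 0 < T) {w : L2 T E} {p g : L2 T F}
    (hp : p =ᵐ[intervalMeasure T] fun t => A (w t)) (hwg : IsWeakDeriv p g) :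
    ∃ (z : ℕ → ℝ → E) (Z : ℕ → L2 T E) (G : ℕ → L2 T F), (∀ n, ContDiff ℝ 1 (z n)) ∧
      (∀ n, Z n =ᵐ[intervalMeasure T] z n) ∧
      (∀ n, G n =ᵐ[intervalMeasure T] fun t => A (deriv (z n) t)) ∧
      Tendsto Z atTop (𝓝 w) ∧ Tendsto G atTop (𝓝 g) := by
  have hw := Lp.memLp w
  have hg := Lp.memLp g
  refine ⟨fun n => regularize T hT n w, fun n => (memLp_regularize hT n hw).toLp _,
    fun n => (1 - 1 / ((n : ℝ) + 2)) • (memLp_regularize hT n hg).toLp _,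
    fun n => contDiff_regularize hT n (integrableOn_of_memLp_two hw),
    fun n => MemLp.coeFn_toLp _, fun n => ?_, ?_, ?_⟩
  · filter_upwards [Lp.coeFn_smul (1 - 1 / ((n : ℝ) + 2)) ((memLp_regularize hT n hg).toLp _),
      (memLp_regularize hT n hg).coeFn_toLp, ae_restrict_mem measurableSet_Ioo] with t h1 h2 ht
    have hn : (0 : ℝ) < n + 2 := by positivity
    have hn0 : (0 : ℝ) ≤ n := by positivity
    change _ = A (deriv (mollify T _ _ w) t)
    rw [h1, Pi.smul_apply, h2, (hasDerivAt_mollify (bump T hT n).contDiff_normed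
      (bump T hT n).hasCompactSupport_normed (integrableOn_of_memLp_two hw) t).deriv,
      map_real_smul A A.continuous, map_mollify_deriv A (integrableOn_of_memLp_two hw) ?_ ?_
      (bump T hT n).contDiff_normed (r := (bump T hT n).rOut) ?_ ?_ (Ioo_subset_Icc_self ht)]
    · rfl
    · rw [div_lt_one hn]; linarith
    · intro φ h3 h4 h5
      rw [← hwg φ h3 h4 h5]
      refine integral_congr_ae ?_
      filter_upwards [hp] with t ht
      rw [ht]
    · change T / (4 * (n + 2)) < _
      rw [div_lt_iff₀ (by positivity)]
      field_simp
      linarith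
    · rw [ContDiffBump.tsupport_normed_eq]
  · have := (Lp.tendsto_Lp_iff_tendsto_eLpNorm'' (fun n => regularize T hT n w)
      (fun n => memLp_regularize hT n hw) _ hw).2 (tendsto_eLpNorm_regularize_sub hT hw)
    rwa [Lp.toLp_coeFn] at this
  · have h1 := (Lp.tendsto_Lp_iff_tendsto_eLpNorm'' (fun n => regularize T hT n g)
      (fun n => memLp_regularize hT n hg) _ hg).2 (tendsto_eLpNorm_regularize_sub hT hg)
    rw [Lp.toLp_coeFn] at h1
    have h2 : Tendsto (fun n : ℕ => 1 - 1 / ((n : ℝ) + 2)) atTop (𝓝 (1 - 0)) :=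
      tendsto_const_nhds.sub (tendsto_const_nhds.div_atTop
        (tendsto_atTop_add_const_right _ _ tendsto_natCast_atTop_atTop))
    simpa using h2.smul h1

end Mollifier

/-! ### Primitives and one-dimensional Sobolev functions -/

section Primitive

theorem integral_mul_sq_le {α : Type*} [MeasurableSpace α] {μ : Measure α} {f g : α → ℝ}
    (hf : MemLp f 2 μ) (hg : MemLp g 2 μ) :
    (∫ x, f x * g x ∂μ) ^ 2 ≤ (∫ x, f x ^ 2 ∂μ) * ∫ x, g x ^ 2 ∂μ := by
  have key : ∀ {p q : α → ℝ} (hp : MemLp p 2 μ) (hq : MemLp q 2 μ),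
      inner ℝ (hp.toLp p) (hq.toLp q) = ∫ x, p x * q x ∂μ := by
    intro p q hp hq
    rw [L2.inner_def]
    refine integral_congr_ae ?_
    filter_upwards [hp.coeFn_toLp, hq.coeFn_toLp] with x h1 h2
    rw [h1, h2, real_inner_eq_re_inner, RCLike.inner_apply]
    simp [mul_comm]
  have h := real_inner_mul_inner_self_le (hf.toLp f) (hg.toLp g)
  rw [key hf hg, key hf hf, key hg hg] at h
  simpa only [pow_two] using h

variable {E F : Type*} [NormedAddCommGroup E] [NormedAddCommGroup F] {T : ℝ}

theorem L2.norm_sq_eq (u : L2 T E) : ‖u‖ ^ 2 = ∫ t in Ioo 0 T, ‖u t‖ ^ 2 := by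
  have h := eLpNorm_nnreal_pow_eq_lintegral (μ := intervalMeasure T) (f := u) (p := 2) (by norm_num)
  have h1 := (Lp.memLp u).integrable_norm_rpow (by norm_num) (by norm_num)
  rw [Lp.norm_def, ← ENNReal.toReal_pow, integral_eq_lintegral_of_nonneg_ae
    (Eventually.of_forall fun t => by positivity) (by simpa using h1.1)]
  congr 1
  simp only [NNReal.coe_ofNat, ENNReal.coe_ofNat, ENNReal.rpow_ofNat] at h
  rw [h]
  congr 1
  ext t
  rw [ENNReal.ofReal_pow (norm_nonneg _), ofReal_norm]

theorem L2.integrable_norm_sq (u : L2 T E) :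
    Integrable (fun t => ‖u t‖ ^ 2) (intervalMeasure T) := by
  simpa using (Lp.memLp u).integrable_norm_rpow (by norm_num) (by norm_num)

theorem L2.integrable_norm_mul_norm (u : L2 T E) (v : L2 T F) :
    Integrable (fun t => ‖u t‖ * ‖v t‖) (intervalMeasure T) :=
  (Lp.memLp u).norm.integrable_mul (Lp.memLp v).norm

theorem L2.integral_norm_mul_norm_le (u : L2 T E) (v : L2 T F) :
    ∫ t in Ioo 0 T, ‖u t‖ * ‖v t‖ ≤ ‖u‖ * ‖v‖ := by
  have h := integral_mul_sq_le (Lp.memLp u).norm (Lp.memLp v).norm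
  rw [← L2.norm_sq_eq, ← L2.norm_sq_eq, ← mul_pow] at h
  exact (le_abs_self _).trans (abs_le_of_sq_le_sq h (by positivity))

theorem intervalIntegral_eq_setIntegral_Ioo {t : ℝ} (ht : 0 ≤ t) [NormedSpace ℝ E] (f : ℝ → E) :
    ∫ s in (0 : ℝ)..t, f s = ∫ s in Ioo 0 t, f s := by
  rw [intervalIntegral.integral_of_le ht, integral_Ioc_eq_integral_Ioo]

theorem IntegrableOn.intervalIntegrable_zero {f : ℝ → E} (hf : IntegrableOn f (Ioo 0 T)) {t : ℝ}
    (ht : t ∈ Icc 0 T) : IntervalIntegrable f volume 0 t := by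
  rw [intervalIntegrable_iff_integrableOn_Ioo_of_le ht.1]
  exact hf.mono_set (Ioo_subset_Ioo_right ht.2)

theorem L2.memLp_Ioo (w : L2 T E) {t : ℝ} (ht : t ∈ Icc 0 T) :
    MemLp w 2 (volume.restrict (Ioo 0 t)) :=
  (Lp.memLp w).mono_measure (Measure.restrict_mono (Ioo_subset_Ioo_right ht.2) le_rfl)

/-- Two functions that are continuous on `[0,T]` and agree almost everywhere agree at `0`. -/
theorem eq_at_zero_of_ae_eq (hT : 0 < T) {f g : ℝ → E} (hf : ContinuousOn f (Icc 0 T))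
    (hg : ContinuousOn g (Icc 0 T)) (hfg : f =ᵐ[intervalMeasure T] g) : f 0 = g 0 := by
  have h : EqOn f g (Icc 0 T) := by
    apply Measure.eqOn_Icc_of_ae_eq volume hT.ne _ hf hg
    rw [Measure.restrict_congr_set Ioo_ae_eq_Icc.symm]
    exact hfg
  exact h (left_mem_Icc.2 hT.le)

variable [NormedSpace ℝ E] [NormedSpace ℝ F]

theorem continuousOn_primitive_of_integrableOn (hT : 0 < T) {f : ℝ → E}
    (hf : IntegrableOn f (Ioo 0 T)) :
    ContinuousOn (fun t => ∫ s in (0 : ℝ)..t, f s) (Icc 0 T) := by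
  have := intervalIntegral.continuousOn_primitive_interval (μ := volume) (f := f) (a := 0) (b := T)
    (by rw [uIcc_of_le hT.le]; exact (integrableOn_Icc_iff_integrableOn_Ioo).2 hf)
  rwa [uIcc_of_le hT.le] at this

theorem norm_primitive_sq_le {f : ℝ → E} {t : ℝ} (ht : 0 ≤ t)
    (hf : MemLp f 2 (volume.restrict (Ioo 0 t))) :
    ‖∫ s in (0 : ℝ)..t, f s‖ ^ 2 ≤ t * ∫ s in (0 : ℝ)..t, ‖f s‖ ^ 2 := by
  rw [intervalIntegral_eq_setIntegral_Ioo ht, intervalIntegral_eq_setIntegral_Ioo ht]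
  have h1 : ‖∫ s in Ioo 0 t, f s‖ ≤ ∫ s in Ioo 0 t, 1 * ‖f s‖ := by
    simpa using norm_integral_le_integral_norm (μ := volume.restrict (Ioo 0 t)) f
  have h2 := integral_mul_sq_le (μ := volume.restrict (Ioo 0 t)) (memLp_const (1 : ℝ)) hf.norm
  calc _ ≤ (∫ s in Ioo 0 t, 1 * ‖f s‖) ^ 2 := by gcongr
    _ ≤ _ := h2
    _ = _ := by simp [ht]

theorem intervalIntegral_le_of_nonneg {f : ℝ → ℝ} (hf : Integrable f (intervalMeasure T))
    (h0 : ∀ t, 0 ≤ f t) {t : ℝ} (ht : t ∈ Icc 0 T) :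
    ∫ s in (0 : ℝ)..t, f s ≤ ∫ s in Ioo 0 T, f s := by
  rw [intervalIntegral_eq_setIntegral_Ioo ht.1]
  exact setIntegral_mono_set hf (Eventually.of_forall h0) (Ioo_subset_Ioo_right ht.2).eventuallyLE

theorem L2.norm_primitive_sq_le (w : L2 T E) {t : ℝ} (ht : t ∈ Icc 0 T) :
    ‖∫ s in (0 : ℝ)..t, w s‖ ^ 2 ≤ T * ‖w‖ ^ 2 := by
  have h2 := intervalIntegral_le_of_nonneg (L2.integrable_norm_sq w) (fun t => by positivity) ht
  rw [← L2.norm_sq_eq] at h2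
  refine (DampedWave.norm_primitive_sq_le ht.1 (L2.memLp_Ioo w ht)).trans ?_
  exact mul_le_mul ht.2 h2 (intervalIntegral.integral_nonneg ht.1 fun _ _ => by positivity)
    (ht.1.trans ht.2)

theorem L2.memLp_primitive (hT : 0 < T) (w : L2 T E) :
    MemLp (fun t => ∫ s in (0 : ℝ)..t, w s) 2 (intervalMeasure T) := by
  refine MemLp.of_bound (((continuousOn_primitive_of_integrableOn hT
    (integrableOn_of_memLp_two (Lp.memLp w))).mono Ioo_subset_Icc_self).aestronglyMeasurable
      measurableSet_Ioo) (Real.sqrt (T * ‖w‖ ^ 2)) ?_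
  filter_upwards [ae_restrict_mem measurableSet_Ioo] with t ht
  exact Real.le_sqrt_of_sq_le (L2.norm_primitive_sq_le w (Ioo_subset_Icc_self ht))

variable (E) in
/-- The Volterra operator `w ↦ ∫₀ᵗ w` on `L²(0,T;E)`. -/
def volterra (𝕜 : Type*) [RCLike 𝕜] [NormedSpace 𝕜 E] [SMulCommClass ℝ 𝕜 E] (hT : 0 < T) :
    L2 T E →L[𝕜] L2 T E :=
  LinearMap.mkContinuous
    { toFun := fun w => (L2.memLp_primitive hT w).toLp _
      map_add' := fun u w => by
        rw [← MemLp.toLp_add, MemLp.toLp_eq_toLp_iff]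
        filter_upwards [ae_restrict_mem measurableSet_Ioo] with t ht
        have ht' := Ioo_subset_Icc_self ht
        have h := integrableOn_of_memLp_two (Lp.memLp u)
        have h' := integrableOn_of_memLp_two (Lp.memLp w)
        rw [Pi.add_apply, ← intervalIntegral.integral_add
          (IntegrableOn.intervalIntegrable_zero h ht')
          (IntegrableOn.intervalIntegrable_zero h' ht'),
          intervalIntegral_eq_setIntegral_Ioo ht'.1,
          intervalIntegral_eq_setIntegral_Ioo ht'.1]
        exact integral_congr_ae (ae_restrict_of_ae_restrict_of_subset
          (Ioo_subset_Ioo_right ht.2.le) (Lp.coeFn_add u w))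
      map_smul' := fun c w => by
        rw [RingHom.id_apply, ← MemLp.toLp_const_smul, MemLp.toLp_eq_toLp_iff]
        filter_upwards [ae_restrict_mem measurableSet_Ioo] with t ht
        have ht' := Ioo_subset_Icc_self ht
        rw [Pi.smul_apply, ← intervalIntegral.integral_smul,
          intervalIntegral_eq_setIntegral_Ioo ht'.1,
          intervalIntegral_eq_setIntegral_Ioo ht'.1]
        exact integral_congr_ae (ae_restrict_of_ae_restrict_of_subset
          (Ioo_subset_Ioo_right ht.2.le) (Lp.coeFn_smul c w)) } T
    (fun w => by
      refine abs_le_of_sq_le_sq' ?_ (by positivity) |>.2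
      change ‖(L2.memLp_primitive hT w).toLp _‖ ^ 2 ≤ _
      rw [L2.norm_sq_eq]
      calc _ ≤ ∫ t in Ioo 0 T, T * ‖w‖ ^ 2 := by
            refine integral_mono_ae (L2.integrable_norm_sq _) (integrable_const _) ?_
            filter_upwards [(L2.memLp_primitive hT w).coeFn_toLp, ae_restrict_mem measurableSet_Ioo]
              with t h1 ht
            rw [h1]
            exact L2.norm_primitive_sq_le w (Ioo_subset_Icc_self ht)
        _ = _ := by
          simp [hT.le]
          ring)

theorem coeFn_volterra (𝕜 : Type*) [RCLike 𝕜] [NormedSpace 𝕜 E] [SMulCommClass ℝ 𝕜 E]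
    (hT : 0 < T) (w : L2 T E) :
    volterra E 𝕜 hT w =ᵐ[intervalMeasure T] fun t => ∫ s in (0 : ℝ)..t, w s :=
  (L2.memLp_primitive hT w).coeFn_toLp

/-- Primitives of `L²` functions are weakly differentiable (by Fubini's theorem). -/
theorem isWeakDeriv_of_ae_eq_primitive [CompleteSpace E] (hT : 0 < T) {u w : L2 T E} {c : E}
    (h : u =ᵐ[intervalMeasure T] fun t => c + ∫ s in (0 : ℝ)..t, w s) : IsWeakDeriv u w := by
  intro φ hφ hc hs
  have hw := integrableOn_of_memLp_two (Lp.memLp w)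
  have hφ1 : ContDiff ℝ 1 φ := hφ.of_le (by exact_mod_cast le_top)
  have hd : Continuous (deriv φ) := hφ1.continuous_deriv le_rfl
  have hφT : φ T = 0 := by
    by_contra hne
    exact lt_irrefl _ (hs (subset_tsupport φ hne)).2
  have hφ0 : φ 0 = 0 := by
    by_contra hne
    exact lt_irrefl _ (hs (subset_tsupport φ hne)).1
  have hderiv : ∀ a b, a ≤ b → ∫ t in Ioo a b, deriv φ t = φ b - φ a := by
    intro a b hab
    rw [← integral_Ioc_eq_integral_Ioo, ← intervalIntegral.integral_of_le hab]
    exact intervalIntegral.integral_deriv_eq_sub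
      (fun x _ => (hφ1.differentiable one_ne_zero).differentiableAt) (hd.intervalIntegrable _ _)
  have hdI : Integrable (deriv φ) (intervalMeasure T) :=
    (hd.integrableOn_Icc (a := 0) (b := T)).mono_set Ioo_subset_Icc_self
  have hprod : Integrable ({p : ℝ × ℝ | p.2 < p.1}.indicator (fun p => deriv φ p.1 • w p.2))
      ((intervalMeasure T).prod (intervalMeasure T)) :=
    (hdI.smul_prod hw).indicator (measurableSet_lt measurable_snd measurable_fst)
  have hswap := integral_integral_swap
    (f := fun t s => {p : ℝ × ℝ | p.2 < p.1}.indicator (fun p => deriv φ p.1 • w p.2) (t, s)) hprod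
  have hL : ∀ t ∈ Ioo 0 T, ∫ s in Ioo 0 T,
      {p : ℝ × ℝ | p.2 < p.1}.indicator (fun p => deriv φ p.1 • w p.2) (t, s) =
        deriv φ t • ∫ s in (0 : ℝ)..t, w s := by
    intro t ht
    have : (fun s => {p : ℝ × ℝ | p.2 < p.1}.indicator (fun p => deriv φ p.1 • w p.2) (t, s)) =
        (Iio t).indicator (fun s => deriv φ t • w s) := by
      ext s; by_cases hst : s < t <;> simp [hst]
    rw [this, setIntegral_indicator measurableSet_Iio, integral_smul,
      intervalIntegral_eq_setIntegral_Ioo ht.1.le]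
    congr 3
    ext s; simp only [mem_inter_iff, mem_Ioo, mem_Iio]
    exact ⟨fun h => ⟨h.1.1, h.2⟩, fun h => ⟨⟨h.1, h.2.trans ht.2⟩, h.2⟩⟩
  have hR : ∀ s ∈ Ioo 0 T, ∫ t in Ioo 0 T,
      {p : ℝ × ℝ | p.2 < p.1}.indicator (fun p => deriv φ p.1 • w p.2) (t, s) = - (φ s • w s) := by
    intro s hs'
    have : (fun t => {p : ℝ × ℝ | p.2 < p.1}.indicator (fun p => deriv φ p.1 • w p.2) (t, s)) =
        (Ioi s).indicator (fun t => deriv φ t • w s) := by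
      ext t; by_cases hst : s < t <;> simp [hst]
    rw [this, setIntegral_indicator measurableSet_Ioi, integral_smul_const]
    have h2 : Ioo 0 T ∩ Ioi s = Ioo s T := by
      ext t; simp only [mem_inter_iff, mem_Ioo, mem_Ioi]
      exact ⟨fun h => ⟨h.2, h.1.2⟩, fun h => ⟨⟨hs'.1.trans h.1, h.2⟩, h.1⟩⟩
    rw [h2, hderiv _ _ hs'.2.le, hφT, zero_sub, neg_smul]
  rw [setIntegral_congr_fun measurableSet_Ioo hL, setIntegral_congr_fun measurableSet_Ioo hR,
    integral_neg] at hswap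
  rw [← hswap]
  have h1 : ∫ t in Ioo 0 T, deriv φ t • u t =
      ∫ t in Ioo 0 T, (deriv φ t • c + deriv φ t • ∫ s in (0 : ℝ)..t, w s) := by
    refine integral_congr_ae ?_
    filter_upwards [h] with t ht
    rw [ht, smul_add]
  obtain ⟨C, hC⟩ := hd.bounded_above_of_compact_support hc.deriv
  have hI : Integrable (fun t => deriv φ t • ∫ s in (0 : ℝ)..t, w s) (intervalMeasure T) :=
    Integrable.bdd_smul (integrableOn_of_memLp_two (L2.memLp_primitive hT w)) C
      hd.aestronglyMeasurable (Eventually.of_forall hC)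
  rw [h1, integral_add (hdI.smul_const c) hI, integral_smul_const, hderiv 0 T hT.le,
    hφT, hφ0]
  simp

theorem intervalMeasure_neBot (hT : 0 < T) : (ae (intervalMeasure T)).NeBot := by
  rw [ae_neBot]
  intro h
  have := congrArg (fun μ => μ univ) h
  simp at this
  linarith

/-- A function in `H¹(0,T;E)` is the primitive of its weak derivative, up to a constant: for its
regularisations the difference is constant, and this passes to the limit in `L²(0,T;E)`. -/
theorem IsWeakDeriv.exists_ae_eq_primitive [CompleteSpace E] (hT : 0 < T) {u w : L2 T E}
    (h : IsWeakDeriv u w) :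
    ∃ c : E, u =ᵐ[intervalMeasure T] fun t => c + ∫ s in (0 : ℝ)..t, w s := by
  obtain ⟨z, Z, G, hz, hZ, hG, hZu, hGw⟩ := exists_contDiff_approx (𝕜 := ℝ)
    (ContinuousLinearMap.id ℝ E) hT (p := u) (w := u) (Eventually.of_forall fun t => rfl) h
  have hconst : ∀ n,
      (Z n - volterra E ℝ hT (G n) : L2 T E) =ᵐ[intervalMeasure T] fun _ => z n 0 := by
    intro n
    filter_upwards [Lp.coeFn_sub (Z n) (volterra E ℝ hT (G n)), hZ n, coeFn_volterra ℝ hT (G n),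
      ae_restrict_mem measurableSet_Ioo] with t h1 h2 h3 ht
    have h4 : ∫ s in (0 : ℝ)..t, G n s = ∫ s in (0 : ℝ)..t, deriv (z n) s := by
      rw [intervalIntegral_eq_setIntegral_Ioo ht.1.le, intervalIntegral_eq_setIntegral_Ioo ht.1.le]
      exact integral_congr_ae (ae_restrict_of_ae_restrict_of_subset
          (Ioo_subset_Ioo_right ht.2.le) (hG n))
    rw [h1, Pi.sub_apply, h2, h3, h4, intervalIntegral.integral_deriv_eq_sub
      (fun x _ => ((hz n).differentiable one_ne_zero).differentiableAt)
      (((hz n).continuous_deriv le_rfl).intervalIntegrable _ _), sub_sub_cancel]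
  have hlim : Tendsto (fun n => (Z n - volterra E ℝ hT (G n) : L2 T E)) atTop
      (𝓝 (u - volterra E ℝ hT w)) :=
    hZu.sub (((volterra E ℝ hT).continuous.tendsto w).comp hGw)
  obtain ⟨ns, -, hns⟩ := (tendstoInMeasure_of_tendsto_Lp hlim).exists_seq_tendsto_ae
  have hall : ∀ᵐ t ∂intervalMeasure T, Tendsto (fun i => z (ns i) 0) atTop
      (𝓝 ((u - volterra E ℝ hT w : L2 T E) t)) := by
    filter_upwards [hns, ae_all_iff.2 hconst] with t h1 h2
    simpa only [h2] using h1
  have := intervalMeasure_neBot hT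
  obtain ⟨t₀, ht₀⟩ := hall.exists
  refine ⟨(u - volterra E ℝ hT w : L2 T E) t₀, ?_⟩
  filter_upwards [hall, Lp.coeFn_sub u (volterra E ℝ hT w), coeFn_volterra ℝ hT w] with t h1 h2 h3
  rw [tendsto_nhds_unique ht₀ h1, h2, Pi.sub_apply, h3, sub_add_cancel]

end Primitive

/-! ### The duality pairing and continuity in `H` -/

section Pairing

variable {𝕜 V H : Type*} [RCLike 𝕜]
  [NormedAddCommGroup V] [InnerProductSpace 𝕜 V]
  [NormedAddCommGroup H] [InnerProductSpace 𝕜 H] {T : ℝ}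

theorem aestronglyMeasurable_pairing {α : Type*} [MeasurableSpace α] {μ : Measure α}
    {g : α → Antidual 𝕜 V} {w : α → V} (hg : AEStronglyMeasurable g μ)
    (hw : AEStronglyMeasurable w μ) : AEStronglyMeasurable (fun t => g t (w t)) μ := by
  have : Continuous fun q : Antidual 𝕜 V × V => q.1 q.2 := by
    refine continuous_iff_continuousAt.2 fun q => tendsto_iff_norm_sub_tendsto_zero.2 ?_
    have h1 : Tendsto (fun r : Antidual 𝕜 V × V => ‖r.1 - q.1‖ * ‖r.2‖ + ‖q.1‖ * ‖r.2 - q.2‖) (𝓝 q)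
        (𝓝 (‖q.1 - q.1‖ * ‖q.2‖ + ‖q.1‖ * ‖q.2 - q.2‖)) :=
      (by fun_prop : Continuous fun r : Antidual 𝕜 V × V =>
        ‖r.1 - q.1‖ * ‖r.2‖ + ‖q.1‖ * ‖r.2 - q.2‖).tendsto q
    simp only [sub_self, norm_zero, zero_mul, mul_zero, add_zero] at h1
    refine squeeze_zero (fun _ => norm_nonneg _) (fun r => ?_) h1
    have h2 : r.1 r.2 - q.1 q.2 = (r.1 - q.1) r.2 + q.1 (r.2 - q.2) := by simp
    rw [h2]
    exact (norm_add_le _ _).trans (add_le_add ((r.1 - q.1).le_opNorm _) (q.1.le_opNorm _))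
  exact this.comp_aestronglyMeasurable (hg.prodMk hw)

theorem integrable_pairing (g : L2 T (Antidual 𝕜 V)) (w : L2 T V) :
    Integrable (fun t => g t (w t)) (intervalMeasure T) :=
  (L2.integrable_norm_mul_norm g w).mono'
    (aestronglyMeasurable_pairing (Lp.aestronglyMeasurable g) (Lp.aestronglyMeasurable w))
    (Eventually.of_forall fun t => (g t).le_opNorm (w t))

theorem norm_integral_pairing_le (g : L2 T (Antidual 𝕜 V)) (w : L2 T V) {t : ℝ}
    (ht : t ∈ Icc 0 T) : ‖∫ s in (0 : ℝ)..t, g s (w s)‖ ≤ ‖g‖ * ‖w‖ := by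
  calc ‖∫ s in (0 : ℝ)..t, g s (w s)‖ ≤ ∫ s in (0 : ℝ)..t, ‖g s (w s)‖ :=
        intervalIntegral.norm_integral_le_integral_norm ht.1
    _ ≤ ∫ s in Ioo 0 T, ‖g s (w s)‖ :=
        intervalIntegral_le_of_nonneg (integrable_pairing g w).norm (fun _ => norm_nonneg _) ht
    _ ≤ ∫ s in Ioo 0 T, ‖g s‖ * ‖w s‖ :=
        integral_mono (integrable_pairing g w).norm (L2.integrable_norm_mul_norm g w)
          fun t => (g t).le_opNorm (w t)
    _ ≤ _ := L2.integral_norm_mul_norm_le g w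

theorem integral_congr_Ioo {E : Type*} [NormedAddCommGroup E] [NormedSpace ℝ E] {f g : ℝ → E}
    {t : ℝ} (ht : t ∈ Icc 0 T) (h : f =ᵐ[intervalMeasure T] g) :
    ∫ s in (0 : ℝ)..t, f s = ∫ s in (0 : ℝ)..t, g s := by
  rw [intervalIntegral_eq_setIntegral_Ioo ht.1, intervalIntegral_eq_setIntegral_Ioo ht.1]
  exact integral_congr_ae (ae_restrict_of_ae_restrict_of_subset (Ioo_subset_Ioo_right ht.2) h)

theorem tendsto_integral_pairing {g : ℕ → L2 T (Antidual 𝕜 V)} {w : ℕ → L2 T V}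
    {g₀ : L2 T (Antidual 𝕜 V)} {w₀ : L2 T V} (hg : Tendsto g atTop (𝓝 g₀))
    (hw : Tendsto w atTop (𝓝 w₀)) {t : ℝ} (ht : t ∈ Icc 0 T) :
    Tendsto (fun n => ∫ s in (0 : ℝ)..t, g n s (w n s)) atTop
      (𝓝 (∫ s in (0 : ℝ)..t, g₀ s (w₀ s))) := by
  have hii : ∀ (a : L2 T (Antidual 𝕜 V)) (b : L2 T V),
      IntervalIntegrable (fun s => a s (b s)) volume 0 t := fun a b =>
    IntegrableOn.intervalIntegrable_zero (integrable_pairing a b) ht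
  have hsub : ∀ n, (∫ s in (0 : ℝ)..t, g n s (w n s)) - ∫ s in (0 : ℝ)..t, g₀ s (w₀ s) =
      (∫ s in (0 : ℝ)..t, (g n - g₀ : L2 T _) s (w n s)) +
        ∫ s in (0 : ℝ)..t, g₀ s ((w n - w₀ : L2 T V) s) := by
    intro n
    rw [← intervalIntegral.integral_sub (hii _ _) (hii _ _),
      ← intervalIntegral.integral_add (hii _ _) (hii _ _)]
    refine integral_congr_Ioo ht ?_
    filter_upwards [Lp.coeFn_sub (g n) g₀, Lp.coeFn_sub (w n) w₀] with s h1 h2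
    rw [h1, h2]
    simp
  rw [tendsto_iff_norm_sub_tendsto_zero]
  have h1 : Tendsto (fun n => ‖g n - g₀‖ * ‖w n‖ + ‖g₀‖ * ‖w n - w₀‖) atTop
      (𝓝 (0 * ‖w₀‖ + ‖g₀‖ * 0)) :=
    ((tendsto_iff_norm_sub_tendsto_zero.1 hg).mul hw.norm).add
      ((tendsto_iff_norm_sub_tendsto_zero.1 hw).const_mul _)
  rw [zero_mul, mul_zero, add_zero] at h1
  refine squeeze_zero (fun _ => norm_nonneg _) (fun n => ?_) h1
  rw [hsub]
  exact (norm_add_le _ _).trans (add_le_add (norm_integral_pairing_le _ _ ht)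
    (norm_integral_pairing_le _ _ ht))

theorem embAntidual_apply (ι : V →L[𝕜] H) (u v : V) :
    embAntidual ι u v = inner 𝕜 (ι v) (ι u) := rfl

variable [NormedSpace ℝ V]

/-- The energy identity for continuously differentiable functions with values in `V`. -/
theorem norm_sq_map_eq_of_contDiff (ι : V →L[𝕜] H) {z : ℝ → V} (hz : ContDiff ℝ 1 z) (t : ℝ) :
    ‖ι (z t)‖ ^ 2 = ‖ι (z 0)‖ ^ 2 +
      2 * RCLike.re (∫ s in (0 : ℝ)..t, embAntidual ι (deriv z s) (z s)) := by
  let _ := InnerProductSpace.rclikeToReal 𝕜 H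
  have hd : ∀ s, HasDerivAt (fun s => ι (z s)) (ι (deriv z s)) s := fun s =>
    ((ι : V →+ H).toRealLinearMap ι.continuous).hasFDerivAt.comp_hasDerivAt s
      ((hz.differentiable one_ne_zero).differentiableAt.hasDerivAt)
  have hzc := hz.continuous
  have hdc := hz.continuous_deriv le_rfl
  have hcont : Continuous fun s => embAntidual ι (deriv z s) (z s) := by
    simp only [embAntidual_apply]
    fun_prop
  have h := intervalIntegral.integral_eq_sub_of_hasDerivAt (a := 0) (b := t)
    (fun s _ => (hd s).norm_sq) (Continuous.intervalIntegrable (by fun_prop) _ _)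
  have h2 : RCLike.re (∫ s in (0 : ℝ)..t, embAntidual ι (deriv z s) (z s)) =
      ∫ s in (0 : ℝ)..t, RCLike.re (embAntidual ι (deriv z s) (z s)) :=
    (intervalIntegral.intervalIntegral_re (hcont.intervalIntegrable _ _)).symm
  rw [h2, ← intervalIntegral.integral_const_mul, ← sub_eq_iff_eq_add', ← h]
  rfl

/-- The a priori bound behind the embedding of `L²(0,T;V) ∩ H¹(0,T;V')` into `C([0,T];H)`: the
energy identity between `s` and `t`, averaged over `s`. -/
theorem norm_sq_map_le_of_contDiff (ι : V →L[𝕜] H) {z : ℝ → V} (hz : ContDiff ℝ 1 z)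
    {Z : L2 T V} {G : L2 T (Antidual 𝕜 V)} (hZ : Z =ᵐ[intervalMeasure T] z)
    (hG : G =ᵐ[intervalMeasure T] fun t => embAntidual ι (deriv z t)) {t : ℝ} (ht : t ∈ Icc 0 T) :
    T * ‖ι (z t)‖ ^ 2 ≤ ‖ι‖ ^ 2 * ‖Z‖ ^ 2 + T * (4 * (‖G‖ * ‖Z‖)) := by
  have hT : 0 ≤ T := ht.1.trans ht.2
  have hre : ∀ s ∈ Icc 0 T,
      |RCLike.re (∫ r in (0 : ℝ)..s, embAntidual ι (deriv z r) (z r))| ≤ ‖G‖ * ‖Z‖ := by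
    intro s hs
    have h1 : ∫ r in (0 : ℝ)..s, embAntidual ι (deriv z r) (z r) =
        ∫ r in (0 : ℝ)..s, G r (Z r) := by
      refine integral_congr_Ioo hs ?_
      filter_upwards [hZ, hG] with r h1 h2
      rw [h1, h2]
    rw [h1]
    exact (RCLike.abs_re_le_norm _).trans (norm_integral_pairing_le G Z hs)
  have hpt : ∀ s ∈ Icc 0 T, ‖ι (z t)‖ ^ 2 ≤ ‖ι (z s)‖ ^ 2 + 4 * (‖G‖ * ‖Z‖) := by
    intro s hs
    have h1 := norm_sq_map_eq_of_contDiff ι hz t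
    have h2 := norm_sq_map_eq_of_contDiff ι hz s
    have h3 := (abs_le.1 (hre t ht)).2
    have h4 := (abs_le.1 (hre s hs)).1
    linarith
  have hzc := hz.continuous
  have hI : Integrable (fun s => ‖ι (z s)‖ ^ 2) (intervalMeasure T) :=
    ((by fun_prop : Continuous fun s => ‖ι (z s)‖ ^ 2).integrableOn_Icc (a := 0) (b := T)).mono_set
      Ioo_subset_Icc_self
  calc T * ‖ι (z t)‖ ^ 2 = ∫ s in Ioo 0 T, ‖ι (z t)‖ ^ 2 := by simp [hT]
    _ ≤ ∫ s in Ioo 0 T, (‖ι (z s)‖ ^ 2 + 4 * (‖G‖ * ‖Z‖)) :=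
        setIntegral_mono_on (integrable_const _) (hI.fun_add (integrable_const _))
          measurableSet_Ioo fun s hs => hpt s (Ioo_subset_Icc_self hs)
    _ = (∫ s in Ioo 0 T, ‖ι (z s)‖ ^ 2) + T * (4 * (‖G‖ * ‖Z‖)) := by
        rw [integral_add hI (integrable_const _)]; simp [hT]
    _ ≤ _ := by
        gcongr
        rw [L2.norm_sq_eq, ← integral_const_mul]
        refine integral_mono_ae hI ((L2.integrable_norm_sq Z).const_mul _) ?_
        filter_upwards [hZ] with s hs
        rw [hs, ← mul_pow]
        gcongr
        exact ι.le_opNorm _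

/-- Integration by parts against `t ↦ (T - t) v`, for continuously differentiable functions. -/
theorem integral_sub_smul_deriv_of_contDiff [IsScalarTower ℝ 𝕜 V] (ι : V →L[𝕜] H) {z : ℝ → V}
    (hz : ContDiff ℝ 1 z) (v : V) :
    ∫ t in (0 : ℝ)..T, embAntidual ι (deriv z t) ((T - t) • v) =
      (∫ t in (0 : ℝ)..T, embAntidual ι (z t) v) - T • inner 𝕜 (ι v) (ι (z 0)) := by
  set ℓ : V →L[𝕜] 𝕜 := (innerSL 𝕜 (ι v)).comp ι with hℓ
  have hd : ∀ s, HasDerivAt (fun s => ℓ (z s)) (ℓ (deriv z s)) s := fun s =>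
    ((ℓ : V →+ 𝕜).toRealLinearMap ℓ.continuous).hasFDerivAt.comp_hasDerivAt s
      ((hz.differentiable one_ne_zero).differentiableAt.hasDerivAt)
  have hzc := hz.continuous
  have hdc := hz.continuous_deriv le_rfl
  have hd2 : ∀ s, HasDerivAt (fun s => (T - s) • ℓ (z s))
      ((T - s) • ℓ (deriv z s) + (-1 : ℝ) • ℓ (z s)) s := fun s =>
    ((hasDerivAt_id s).const_sub T).smul (hd s)
  have h := intervalIntegral.integral_eq_sub_of_hasDerivAt (a := 0) (b := T)
    (fun s _ => hd2 s) (Continuous.intervalIntegrable (by fun_prop) _ _)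
  rw [intervalIntegral.integral_add (Continuous.intervalIntegrable (by fun_prop) _ _)
    (Continuous.intervalIntegrable (by fun_prop) _ _)] at h
  simp only [sub_self, zero_smul, sub_zero, zero_sub, neg_smul, one_smul,
    intervalIntegral.integral_neg] at h
  have h1 : ∀ t, embAntidual ι (deriv z t) ((T - t) • v) = (T - t) • ℓ (deriv z t) := by
    intro t
    rw [map_real_smul (embAntidual ι (deriv z t)) (ContinuousLinearMap.continuous _)]
    rfl
  simp only [h1]
  have h2 : ∀ t, embAntidual ι (z t) v = ℓ (z t) := fun t => rfl
  have h3 : inner 𝕜 (ι v) (ι (z 0)) = ℓ (z 0) := rfl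
  simp only [h2, h3]
  rw [← sub_eq_add_neg] at h
  rw [sub_eq_iff_eq_add.1 h]
  abel

/-- A function `w ∈ L²(0,T;V)` with weak derivative `g ∈ L²(0,T;V')` has a representative in
`C([0,T];H)`, for which the energy identity holds, and integration by parts against `t ↦ (T - t) v`
detects the value at `0`. The representative is the uniform limit of the regularisations of `w`. -/
theorem exists_continuousOn_representative [CompleteSpace V] [CompleteSpace H]
    [IsScalarTower ℝ 𝕜 V] (ι : V →L[𝕜] H) (hT : 0 < T) {w : L2 T V} {g : L2 T (Antidual 𝕜 V)}
    (hg : IsWeakDeriv ((embAntidual ι).compLp w) g) :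
    ∃ h : ℝ → H, ContinuousOn h (Icc 0 T) ∧ ι.compLp w =ᵐ[intervalMeasure T] h ∧
      (∀ t ∈ Icc 0 T, ‖h t‖ ^ 2 = ‖h 0‖ ^ 2 + 2 * RCLike.re (∫ s in (0 : ℝ)..t, g s (w s))) ∧
      ∀ v : V, ∫ t in (0 : ℝ)..T, g t ((T - t) • v) =
        (∫ t in (0 : ℝ)..T, embAntidual ι (w t) v) - T • inner 𝕜 (ι v) (h 0) := by
  obtain ⟨z, Z, G, hz, hZ, hG, hZw, hGg⟩ := exists_contDiff_approx (embAntidual ι) hT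
    (ContinuousLinearMap.coeFn_compLp (embAntidual ι) w) hg
  have h0T : (0 : ℝ) ∈ Icc 0 T := left_mem_Icc.2 hT.le
  have hTT : T ∈ Icc 0 T := right_mem_Icc.2 hT.le
  have hsub : ∀ m n, ∀ t ∈ Icc 0 T, T * ‖ι (z m t) - ι (z n t)‖ ^ 2 ≤
      ‖ι‖ ^ 2 * ‖Z m - Z n‖ ^ 2 + T * (4 * (‖G m - G n‖ * ‖Z m - Z n‖)) := by
    intro m n t ht
    have h1 := norm_sq_map_le_of_contDiff ι ((hz m).sub (hz n)) (Z := Z m - Z n) (G := G m - G n)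
      (by filter_upwards [hZ m, hZ n, Lp.coeFn_sub (Z m) (Z n)] with t h1 h2 h3
          rw [h3, Pi.sub_apply, h1, h2])
      (by filter_upwards [hG m, hG n, Lp.coeFn_sub (G m) (G n)] with t h1 h2 h3
          rw [h3, Pi.sub_apply, h1, h2, ← map_sub]
          congr 1
          exact (deriv_fun_sub ((hz m).differentiable one_ne_zero).differentiableAt
            ((hz n).differentiable one_ne_zero).differentiableAt).symm) ht
    rwa [map_sub] at h1
  have hcau : UniformCauchySeqOn (fun n t => ι (z n t)) atTop (Icc 0 T) := by
    rw [Metric.uniformCauchySeqOn_iff]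
    intro ε hε
    set c : ℝ := ‖ι‖ ^ 2 + T * 4 with hc
    have hc0 : 0 < c := by positivity
    -- The radius `δ` is chosen so that `c * δ ^ 2 = T * ε ^ 2`.
    have hδ : 0 < Real.sqrt (T / c) * ε := by positivity
    obtain ⟨N₁, hN₁⟩ := Metric.cauchySeq_iff.1 hZw.cauchySeq _ hδ
    obtain ⟨N₂, hN₂⟩ := Metric.cauchySeq_iff.1 hGg.cauchySeq _ hδ
    refine ⟨max N₁ N₂, fun m hm n hn t ht => ?_⟩
    have h1 := hN₁ m (le_of_max_le_left hm) n (le_of_max_le_left hn)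
    have h2 := hN₂ m (le_of_max_le_right hm) n (le_of_max_le_right hn)
    rw [dist_eq_norm] at h1 h2 ⊢
    set δ := Real.sqrt (T / c) * ε with hδdef
    have hδ2 : c * δ ^ 2 = T * ε ^ 2 := by
      rw [hδdef, mul_pow, Real.sq_sqrt (by positivity)]
      field_simp
    have h3 : ‖Z m - Z n‖ ^ 2 < δ ^ 2 := by gcongr
    have h4 : ‖G m - G n‖ * ‖Z m - Z n‖ < δ ^ 2 := by
      rw [pow_two]
      exact mul_lt_mul'' h2 h1 (norm_nonneg _) (norm_nonneg _)
    have h5 : T * ‖ι (z m t) - ι (z n t)‖ ^ 2 < T * ε ^ 2 := by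
      calc _ ≤ _ := hsub m n t ht
        _ < ‖ι‖ ^ 2 * δ ^ 2 + T * (4 * δ ^ 2) :=
          add_lt_add_of_le_of_lt (by gcongr) (by gcongr)
        _ = c * δ ^ 2 := by ring
        _ = _ := hδ2
    exact lt_of_pow_lt_pow_left₀ 2 hε.le (lt_of_mul_lt_mul_left h5 hT.le)
  have hlim : ∀ t, ∃ x, t ∈ Icc 0 T → Tendsto (fun n => ι (z n t)) atTop (𝓝 x) := by
    intro t
    by_cases ht : t ∈ Icc 0 T
    · obtain ⟨x, hx⟩ := cauchySeq_tendsto_of_complete (hcau.cauchySeq ht)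
      exact ⟨x, fun _ => hx⟩
    · exact ⟨0, fun h => absurd h ht⟩
  choose h hh using hlim
  have hunif := hcau.tendstoUniformlyOn_of_tendsto hh
  refine ⟨h, hunif.continuousOn (Frequently.of_forall fun n =>
    (ι.continuous.comp (hz n).continuous).continuousOn), ?_, fun t ht => ?_, fun v => ?_⟩
  · obtain ⟨ns, hmono, hns⟩ := (tendstoInMeasure_of_tendsto_Lp hZw).exists_seq_tendsto_ae
    filter_upwards [hns, ae_all_iff.2 hZ, ContinuousLinearMap.coeFn_compLp ι w,
      ae_restrict_mem measurableSet_Ioo] with t h1 h2 h3 ht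
    rw [h3]
    refine tendsto_nhds_unique ((ι.continuous.tendsto _).comp h1) ?_
    simp only [Function.comp_def, h2]
    exact (hh t (Ioo_subset_Icc_self ht)).comp hmono.tendsto_atTop
  · have h1 : ∀ n, ∫ s in (0 : ℝ)..t, embAntidual ι (deriv (z n) s) (z n s) =
        ∫ s in (0 : ℝ)..t, G n s (Z n s) := by
      intro n
      refine integral_congr_Ioo ht ?_
      filter_upwards [hZ n, hG n] with r h1 h2
      rw [h1, h2]
    have h2 : ∀ n, ‖ι (z n t)‖ ^ 2 = ‖ι (z n 0)‖ ^ 2 +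
        2 * RCLike.re (∫ s in (0 : ℝ)..t, G n s (Z n s)) := fun n => by
      rw [← h1]
      exact norm_sq_map_eq_of_contDiff ι (hz n) t
    have h3 := ((hh t ht).norm.pow 2)
    simp only [h2] at h3
    refine tendsto_nhds_unique h3 (((hh 0 h0T).norm.pow 2).add (Tendsto.const_mul _ ?_))
    exact (RCLike.continuous_re.tendsto _).comp (tendsto_integral_pairing hGg hZw ht)
  · have hφ : MemLp (fun t => (T - t) • v) 2 (intervalMeasure T) := by
      have hc : Continuous fun t => (T - t) • v := by fun_prop
      obtain ⟨C, hC⟩ := isCompact_Icc.exists_bound_of_continuousOn (s := Icc 0 T) hc.continuousOn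
      refine MemLp.of_bound hc.aestronglyMeasurable C ?_
      filter_upwards [ae_restrict_mem measurableSet_Ioo] with t ht
      exact hC t (Ioo_subset_Icc_self ht)
    have hv : MemLp (fun _ : ℝ => v) 2 (intervalMeasure T) := memLp_const v
    have hL : ∀ a : L2 T (Antidual 𝕜 V), ∫ t in (0 : ℝ)..T, a t ((T - t) • v) =
        ∫ t in (0 : ℝ)..T, a t (hφ.toLp _ t) := fun a => by
      refine integral_congr_Ioo hTT ?_
      filter_upwards [hφ.coeFn_toLp] with t ht
      rw [ht]
    have hR : ∀ a : L2 T V, ∫ t in (0 : ℝ)..T, embAntidual ι (a t) v =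
        ∫ t in (0 : ℝ)..T, (embAntidual ι).compLp a t (hv.toLp _ t) := fun a => by
      refine integral_congr_Ioo hTT ?_
      filter_upwards [hv.coeFn_toLp, ContinuousLinearMap.coeFn_compLp (embAntidual ι) a]
        with t ht h1
      rw [ht, h1]
    have hn : ∀ n, ∫ t in (0 : ℝ)..T, G n t (hφ.toLp _ t) =
        (∫ t in (0 : ℝ)..T, (embAntidual ι).compLp (Z n) t (hv.toLp _ t)) -
          T • inner 𝕜 (ι v) (ι (z n 0)) := by
      intro n
      have e1 : ∫ t in (0 : ℝ)..T, G n t ((T - t) • v) =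
          ∫ t in (0 : ℝ)..T, embAntidual ι (deriv (z n) t) ((T - t) • v) := by
        refine integral_congr_Ioo hTT ?_
        filter_upwards [hG n] with t ht
        rw [ht]
      have e2 : ∫ t in (0 : ℝ)..T, embAntidual ι (Z n t) v =
          ∫ t in (0 : ℝ)..T, embAntidual ι (z n t) v := by
        refine integral_congr_Ioo hTT ?_
        filter_upwards [hZ n] with t ht
        rw [ht]
      rw [← hL, ← hR, e1, e2, integral_sub_smul_deriv_of_contDiff ι (hz n) v]
    have h3 := tendsto_integral_pairing hGg (tendsto_const_nhds (x := hφ.toLp _)) hTT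
    simp only [hn] at h3
    rw [hL, hR]
    refine tendsto_nhds_unique h3 (Tendsto.sub (tendsto_integral_pairing ?_ tendsto_const_nhds hTT)
      (Tendsto.const_smul ?_ T))
    · exact (((embAntidual ι).compLpL 2 (intervalMeasure T)).continuous.tendsto w).comp hZw
    · exact ((innerSL 𝕜 (ι v)).continuous.tendsto _).comp (hh 0 h0T)

end Pairing

/-! ### The a priori estimate and uniqueness -/

/-- Gronwall's inequality in integral form. -/
theorem le_mul_exp_of_le_integral {T c D : ℝ} (hc : 0 < c) {y : ℝ → ℝ}
    (hy : ContinuousOn y (Icc 0 T)) (hy0 : ∀ t ∈ Icc 0 T, 0 ≤ y t)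
    (h : ∀ t ∈ Icc 0 T, y t ≤ D + c * ∫ s in (0 : ℝ)..t, y s) {t : ℝ} (ht : t ∈ Icc 0 T) :
    y t ≤ D * Real.exp (c * t) := by
  have hT : 0 ≤ T := ht.1.trans ht.2
  -- Composing with the projection `p` onto `[0,T]` extends `y` to a continuous function on `ℝ`.
  set p : ℝ → ℝ := fun s => max 0 (min s T) with hp
  have hpI : ∀ s, p s ∈ Icc 0 T := fun s => ⟨le_max_left _ _, max_le hT (min_le_right _ _)⟩
  have hpe : ∀ s ∈ Icc 0 T, p s = s := fun s hs => by
    rw [hp]; simp [hs.1, hs.2]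
  have hz : Continuous fun s => y (p s) := hy.comp_continuous (by fun_prop) hpI
  have hI : ∀ s ∈ Icc 0 T, ∫ r in (0 : ℝ)..s, y (p r) = ∫ r in (0 : ℝ)..s, y r := by
    intro s hs
    refine intervalIntegral.integral_congr fun r hr => ?_
    rw [uIcc_of_le hs.1] at hr
    simp only [hpe r ⟨hr.1, hr.2.trans hs.2⟩]
  have hd : ∀ s, HasDerivAt (fun s => ∫ r in (0 : ℝ)..s, y (p r)) (y (p s)) s := fun s =>
    intervalIntegral.integral_hasDerivAt_right (hz.intervalIntegrable _ _)
      (hz.stronglyMeasurableAtFilter _ _) hz.continuousAt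
  have hpos : ∀ s ∈ Icc 0 T, 0 ≤ ∫ r in (0 : ℝ)..s, y (p r) := fun s hs =>
    intervalIntegral.integral_nonneg hs.1 fun r _ => hy0 _ (hpI r)
  have hg := norm_le_gronwallBound_of_norm_deriv_right_le (δ := 0) (K := c) (ε := D)
    (f := fun s => ∫ r in (0 : ℝ)..s, y (p r)) (f' := fun s => y (p s)) (a := 0) (b := T)
    (fun s _ => (hd s).continuousAt.continuousWithinAt) (fun s _ => (hd s).hasDerivWithinAt)
    (by simp) (fun s hs => by
      have hs' := Ico_subset_Icc_self hs
      rw [Real.norm_of_nonneg (hpos s hs'), Real.norm_of_nonneg (hy0 _ (hpI s)), hpe s hs',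
        hI s hs']
      linarith [h s hs']) t ht
  rw [Real.norm_of_nonneg (hpos t ht), hI t ht, gronwallBound_of_K_ne_0 hc.ne', sub_zero] at hg
  have h1 := h t ht
  have h2 := mul_le_mul_of_nonneg_left hg hc.le
  have h3 : c * (0 * Real.exp (c * t) + D / c * (Real.exp (c * t) - 1)) =
      D * Real.exp (c * t) - D := by
    field_simp
    ring
  linarith

section Estimate

variable {𝕜 V H : Type*} [RCLike 𝕜]
  [NormedAddCommGroup V] [InnerProductSpace 𝕜 V]
  [NormedAddCommGroup H] [InnerProductSpace 𝕜 H] {T : ℝ}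

theorem NonautonomousForm.exists_bound (a : NonautonomousForm 𝕜 V T) :
    ∃ M : ℝ, 0 ≤ M ∧ ∀ t ∈ Icc 0 T, ∀ u v : V, ‖a.form t u v‖ ≤ M * ‖u‖ * ‖v‖ := by
  obtain ⟨M, hM⟩ := a.bounded
  refine ⟨|M|, abs_nonneg _, fun t ht u v => (hM t ht u v).trans ?_⟩
  gcongr
  exact le_abs_self M

theorem NonautonomousForm.norm_op_apply_le {a : NonautonomousForm 𝕜 V T} {M : ℝ} (hM0 : 0 ≤ M)
    (hM : ∀ t ∈ Icc 0 T, ∀ u v : V, ‖a.form t u v‖ ≤ M * ‖u‖ * ‖v‖) (t : ℝ) (ht : t ∈ Icc 0 T)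
    (u : V) : ‖a.op t ht u‖ ≤ M * ‖u‖ :=
  ContinuousLinearMap.opNorm_le_bound _ (by positivity) fun v => hM t ht u v

theorem L2.integrable_smul {E : Type*} [NormedAddCommGroup E] [NormedSpace ℝ E] {ψ : ℝ → ℝ}
    (hψ : Continuous ψ) (hc : HasCompactSupport ψ) (v : L2 T E) :
    Integrable (fun t => ψ t • v t) (intervalMeasure T) := by
  obtain ⟨C, hC⟩ := hψ.bounded_above_of_compact_support hc
  exact Integrable.bdd_smul (integrableOn_of_memLp_two (Lp.memLp v)) C
    hψ.aestronglyMeasurable (Eventually.of_forall hC)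

theorem IsWeakDeriv.compLp {E F : Type*} [NormedAddCommGroup E] [NormedSpace ℝ E]
    [NormedAddCommGroup F] [NormedSpace ℝ F] [NormedSpace 𝕜 E] [NormedSpace 𝕜 F]
    [CompleteSpace E] [CompleteSpace F] {u g : L2 T E} (h : IsWeakDeriv u g) (A : E →L[𝕜] F) :
    IsWeakDeriv (A.compLp u) (A.compLp g) := by
  intro φ hφ hc hs
  have hint : ∀ (ψ : ℝ → ℝ), Continuous ψ → HasCompactSupport ψ → ∀ v : L2 T E,
      ∫ t in Ioo 0 T, ψ t • A.compLp v t = A (∫ t in Ioo 0 T, ψ t • v t) := by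
    intro ψ hψ hψc v
    rw [← A.integral_comp_comm (L2.integrable_smul hψ hψc v)]
    refine integral_congr_ae ?_
    filter_upwards [A.coeFn_compLp v] with t ht
    rw [ht, map_real_smul A A.continuous]
  rw [hint _ ((hφ.of_le (by exact_mod_cast le_top) : ContDiff ℝ 1 φ).continuous_deriv le_rfl)
    hc.deriv, hint _ hφ.continuous hc, h φ hφ hc hs, map_neg]

theorem IsWeakDeriv.sub {E : Type*} [NormedAddCommGroup E] [NormedSpace ℝ E]
    {u g v k : L2 T E} (h : IsWeakDeriv u g) (h' : IsWeakDeriv v k) :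
    IsWeakDeriv (u - v) (g - k) := by
  intro φ hφ hc hs
  have hint : ∀ (ψ : ℝ → ℝ), Continuous ψ → HasCompactSupport ψ → ∀ p q : L2 T E,
      ∫ t in Ioo 0 T, ψ t • (p - q : L2 T E) t =
        (∫ t in Ioo 0 T, ψ t • p t) - ∫ t in Ioo 0 T, ψ t • q t := by
    intro ψ hψ hψc p q
    rw [← integral_sub (L2.integrable_smul hψ hψc p) (L2.integrable_smul hψ hψc q)]
    refine integral_congr_ae ?_
    filter_upwards [Lp.coeFn_sub p q] with t ht
    rw [ht, Pi.sub_apply, smul_sub]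
  rw [hint _ ((hφ.of_le (by exact_mod_cast le_top) : ContDiff ℝ 1 φ).continuous_deriv le_rfl)
    hc.deriv, hint _ hφ.continuous hc, h φ hφ hc hs, h' φ hφ hc hs]
  abel

theorem HasInitialValue.sub {E : Type*} [NormedAddCommGroup E] {p q r : L2 T E} {x y : E}
    (hp : HasInitialValue p x) (hq : HasInitialValue q y) (hr : r =ᵐ[intervalMeasure T] ⇑p - ⇑q) :
    HasInitialValue r (x - y) := by
  obtain ⟨p', hp1, hp2, hp3⟩ := hp
  obtain ⟨q', hq1, hq2, hq3⟩ := hq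
  refine ⟨p' - q', hp1.sub hq1, ?_, by rw [Pi.sub_apply, hp3, hq3]⟩
  filter_upwards [hr, hp2, hq2] with t e1 e2 e3
  rw [e1, Pi.sub_apply, Pi.sub_apply, e2, e3]

variable [NormedSpace ℝ V] {ι : V →L[𝕜] H} {a b : NonautonomousForm 𝕜 V T}

section

variable {u₀ : V} {u₁ : H} {f : L2 T (Antidual 𝕜 V)} {u : L2 T V}

theorem IsSolution.isWeakDeriv (h : IsSolution ι a b u₀ u₁ f u) : IsWeakDeriv u (weakDeriv u) :=
  isWeakDeriv_weakDeriv h.mem.1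

variable [CompleteSpace V]

theorem IsSolution.weakDeriv_emb (h : IsSolution ι a b u₀ u₁ f u) :
    weakDeriv ((embAntidual ι).compLp u) = (embAntidual ι).compLp (weakDeriv u) :=
  (h.isWeakDeriv.compLp (embAntidual ι)).weakDeriv_eq

theorem IsSolution.isWeakDeriv_emb (h : IsSolution ι a b u₀ u₁ f u) :
    IsWeakDeriv ((embAntidual ι).compLp (weakDeriv u))
      (weakDeriv ((embAntidual ι).compLp (weakDeriv u))) := by
  rw [← h.weakDeriv_emb]
  exact isWeakDeriv_weakDeriv h.mem.2.2

theorem IsSolution.ae_eq_primitive (hT : 0 < T) (h : IsSolution ι a b u₀ u₁ f u) :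
    u =ᵐ[intervalMeasure T] fun t => u₀ + ∫ s in (0 : ℝ)..t, weakDeriv u s := by
  obtain ⟨c, hc⟩ := h.isWeakDeriv.exists_ae_eq_primitive hT
  obtain ⟨v, hv, huv, hv0⟩ := h.initial
  have h1 := eq_at_zero_of_ae_eq hT hv (continuousOn_const.fun_add
    (continuousOn_primitive_of_integrableOn hT (integrableOn_of_memLp_two (Lp.memLp (weakDeriv u)))))
    (huv.symm.trans hc)
  rw [hv0, intervalIntegral.integral_same, add_zero] at h1
  rwa [h1]

end

/-- The energy estimate: Gronwall's inequality for `‖u̇(t)‖_H² + α ∫₀ᵗ ‖u̇‖_V²`. -/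
theorem exists_norm_weakDeriv_sq_le [CompleteSpace V] [CompleteSpace H] [IsScalarTower ℝ 𝕜 V]
    (hT : 0 < T) (hb : b.QuasiCoercive ι) :
    ∃ K : ℝ, 0 ≤ K ∧ ∀ (u₀ : V) (u₁ : H) (f : L2 T (Antidual 𝕜 V)) (u : L2 T V),
      IsSolution ι a b u₀ u₁ f u → ‖weakDeriv u‖ ^ 2 ≤ K * (‖u₀‖ + ‖u₁‖ + ‖f‖) ^ 2 := by
  obtain ⟨M, hM0, hM⟩ := a.exists_bound
  obtain ⟨α, hα, κ, hκ⟩ := hb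
  -- The first two terms of `c` come from quasi-coercivity and from the form `a`; adding `1` makes
  -- `c` positive.
  set c : ℝ := 2 * |κ| + 4 * M ^ 2 * T / α ^ 2 + 1 with hc
  have hc0 : 0 < c := by positivity
  refine ⟨(1 + 2 / α + 4 * M ^ 2 * T / α) * Real.exp (c * T) / α, by positivity,
    fun u₀ u₁ f u h => ?_⟩
  set w := weakDeriv u with hw
  set g := weakDeriv ((embAntidual ι).compLp w) with hg
  obtain ⟨q, hqc, hqw, hqe, -⟩ := exists_continuousOn_representative ι hT h.isWeakDeriv_emb
  have hq0 : q 0 = u₁ := by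
    obtain ⟨v, hv, huv, hv0⟩ := h.initial_deriv
    rw [← hv0]
    exact eq_at_zero_of_ae_eq hT hqc hv (hqw.symm.trans huv)
  have hTT : T ∈ Icc 0 T := right_mem_Icc.2 hT.le
  have hw2 := L2.integrable_norm_sq w
  have hf2 := L2.integrable_norm_sq f
  set y : ℝ → ℝ := fun t => ‖q t‖ ^ 2 + α * ∫ s in (0 : ℝ)..t, ‖w s‖ ^ 2 with hy
  have hyc : ContinuousOn y (Icc 0 T) :=
    (hqc.norm.pow 2).add (continuousOn_const.mul (continuousOn_primitive_of_integrableOn hT hw2))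
  have hwpos : ∀ t ∈ Icc 0 T, 0 ≤ ∫ s in (0 : ℝ)..t, ‖w s‖ ^ 2 := fun t ht =>
    intervalIntegral.integral_nonneg ht.1 fun s _ => by positivity
  have hy0 : ∀ t ∈ Icc 0 T, 0 ≤ y t := fun t ht =>
    add_nonneg (by positivity) (mul_nonneg hα.le (hwpos t ht))
  have hyI : Integrable y (intervalMeasure T) := hyc.integrableOn_Icc.mono_set Ioo_subset_Icc_self
  -- The pointwise bound for the right-hand side of the energy identity.
  have hpt : ∀ᵐ s ∂intervalMeasure T, 2 * RCLike.re (g s (w s)) ≤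
      -(α * ‖w s‖ ^ 2) + 2 / α * ‖f s‖ ^ 2 + 4 * M ^ 2 / α * ‖u₀‖ ^ 2 + c * y s := by
    filter_upwards [h.equation, h.ae_eq_primitive hT, hqw, ContinuousLinearMap.coeFn_compLp ι w,
      ae_restrict_mem measurableSet_Ioo] with s heq hus hqs hιw hs
    have hs' := Ioo_subset_Icc_self hs
    have e1 := heq hs'
    rw [h.weakDeriv_emb] at e1
    have e2 : g s (w s) = f s (w s) - b.form s (w s) (w s) - a.form s (u s) (w s) := by
      rw [← e1]
      simp only [add_apply, NonautonomousForm.op_apply]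
      ring
    have e3 : RCLike.re (g s (w s)) = RCLike.re (f s (w s)) - RCLike.re (b.form s (w s) (w s)) -
        RCLike.re (a.form s (u s) (w s)) := by
      rw [e2, map_sub, map_sub]
    have e4 : RCLike.re (f s (w s)) ≤ ‖f s‖ * ‖w s‖ :=
      (RCLike.re_le_norm _).trans ((f s).le_opNorm _)
    have e5 : -RCLike.re (a.form s (u s) (w s)) ≤ M * ‖u s‖ * ‖w s‖ :=
      (neg_le_abs _).trans ((RCLike.abs_re_le_norm _).trans (hM s hs' _ _))
    have e6 := hκ s hs' (w s)
    have e7 : ‖ι (w s)‖ = ‖q s‖ := by rw [← hιw, hqs]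
    have e8 : κ * ‖ι (w s)‖ ^ 2 ≤ |κ| * ‖q s‖ ^ 2 := by
      rw [e7]; gcongr; exact le_abs_self _
    have e9 : ‖u s‖ ^ 2 ≤ 2 * ‖u₀‖ ^ 2 + 2 * (T * ∫ r in (0 : ℝ)..s, ‖w r‖ ^ 2) := by
      have p1 : ‖u s‖ ≤ ‖u₀‖ + ‖∫ r in (0 : ℝ)..s, w r‖ := by rw [hus]; exact norm_add_le _ _
      have p2 := norm_primitive_sq_le hs'.1 (L2.memLp_Ioo w hs')
      have p3 : s * ∫ r in (0 : ℝ)..s, ‖w r‖ ^ 2 ≤ T * ∫ r in (0 : ℝ)..s, ‖w r‖ ^ 2 :=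
        mul_le_mul_of_nonneg_right hs'.2 (hwpos s hs')
      nlinarith [sq_nonneg (‖u₀‖ - ‖∫ r in (0 : ℝ)..s, w r‖), norm_nonneg (u s)]
    -- Young's inequality, with half of the coercivity constant spent on each of the two products.
    have e10 : 2 * (‖f s‖ * ‖w s‖) ≤ α / 2 * ‖w s‖ ^ 2 + 2 / α * ‖f s‖ ^ 2 := by
      have : α / 2 * ‖w s‖ ^ 2 + 2 / α * ‖f s‖ ^ 2 - 2 * (‖f s‖ * ‖w s‖) =
          (α * ‖w s‖ - 2 * ‖f s‖) ^ 2 / (2 * α) := by field_simp; ring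
      have : 0 ≤ (α * ‖w s‖ - 2 * ‖f s‖) ^ 2 / (2 * α) := by positivity
      linarith
    have e11 : 2 * (M * ‖u s‖ * ‖w s‖) ≤ α / 2 * ‖w s‖ ^ 2 + 2 * M ^ 2 / α * ‖u s‖ ^ 2 := by
      have : α / 2 * ‖w s‖ ^ 2 + 2 * M ^ 2 / α * ‖u s‖ ^ 2 - 2 * (M * ‖u s‖ * ‖w s‖) =
          (α * ‖w s‖ - 2 * (M * ‖u s‖)) ^ 2 / (2 * α) := by field_simp; ring
      have : 0 ≤ (α * ‖w s‖ - 2 * (M * ‖u s‖)) ^ 2 / (2 * α) := by positivity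
      linarith
    have e12 : 2 * M ^ 2 / α * ‖u s‖ ^ 2 ≤ 4 * M ^ 2 / α * ‖u₀‖ ^ 2 +
        4 * M ^ 2 * T / α ^ 2 * (α * ∫ r in (0 : ℝ)..s, ‖w r‖ ^ 2) := by
      calc _ ≤ 2 * M ^ 2 / α * (2 * ‖u₀‖ ^ 2 + 2 * (T * ∫ r in (0 : ℝ)..s, ‖w r‖ ^ 2)) := by gcongr
        _ = _ := by field_simp; ring
    have e13 : 2 * (|κ| * ‖q s‖ ^ 2) + 4 * M ^ 2 * T / α ^ 2 * (α * ∫ r in (0 : ℝ)..s, ‖w r‖ ^ 2) ≤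
        c * y s := by
      have p1 : ‖q s‖ ^ 2 ≤ y s := le_add_of_nonneg_right (mul_nonneg hα.le (hwpos s hs'))
      have p2 : α * ∫ r in (0 : ℝ)..s, ‖w r‖ ^ 2 ≤ y s := le_add_of_nonneg_left (by positivity)
      calc _ ≤ 2 * (|κ| * y s) + 4 * M ^ 2 * T / α ^ 2 * y s := by gcongr
        _ ≤ 2 * (|κ| * y s) + 4 * M ^ 2 * T / α ^ 2 * y s + y s :=
            le_add_of_nonneg_right (hy0 s hs')
        _ = c * y s := by rw [hc]; ring
    linarith
  have hint : ∀ t ∈ Icc 0 T, y t ≤ (‖u₁‖ ^ 2 + 2 / α * ‖f‖ ^ 2 + 4 * M ^ 2 * T / α * ‖u₀‖ ^ 2) +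
      c * ∫ s in (0 : ℝ)..t, y s := by
    intro t ht
    have hres : ∀ {k : ℝ → ℝ}, Integrable k (intervalMeasure T) →
        IntervalIntegrable k volume 0 t := fun hk => IntegrableOn.intervalIntegrable_zero hk ht
    have i1 : 2 * RCLike.re (∫ s in (0 : ℝ)..t, g s (w s)) =
        ∫ s in (0 : ℝ)..t, 2 * RCLike.re (g s (w s)) := by
      rw [intervalIntegral.integral_const_mul]
      congr 1
      exact (intervalIntegral.intervalIntegral_re
        (IntegrableOn.intervalIntegrable_zero (integrable_pairing g w) ht)).symm
    have i2 : ∫ s in (0 : ℝ)..t, 2 * RCLike.re (g s (w s)) ≤ ∫ s in (0 : ℝ)..t,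
        (-(α * ‖w s‖ ^ 2) + 2 / α * ‖f s‖ ^ 2 + 4 * M ^ 2 / α * ‖u₀‖ ^ 2 + c * y s) := by
      rw [intervalIntegral_eq_setIntegral_Ioo ht.1, intervalIntegral_eq_setIntegral_Ioo ht.1]
      have hsub : Ioo 0 t ⊆ Ioo 0 T := Ioo_subset_Ioo_right ht.2
      refine integral_mono_ae ?_ ?_ (ae_restrict_of_ae_restrict_of_subset hsub hpt)
      · exact (((integrable_pairing g w).re.const_mul 2).mono_measure
          (Measure.restrict_mono hsub le_rfl))
      · exact (((((hw2.const_mul α).neg.add (hf2.const_mul _)).add (integrable_const _)).add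
          (hyI.const_mul c)).mono_measure (Measure.restrict_mono hsub le_rfl))
    have i3 : ∫ s in (0 : ℝ)..t,
        (-(α * ‖w s‖ ^ 2) + 2 / α * ‖f s‖ ^ 2 + 4 * M ^ 2 / α * ‖u₀‖ ^ 2 + c * y s) =
        -(α * ∫ s in (0 : ℝ)..t, ‖w s‖ ^ 2) + 2 / α * (∫ s in (0 : ℝ)..t, ‖f s‖ ^ 2) +
          t * (4 * M ^ 2 / α * ‖u₀‖ ^ 2) + c * ∫ s in (0 : ℝ)..t, y s := by
      have j1 : IntervalIntegrable (fun s => -(α * ‖w s‖ ^ 2)) volume 0 t :=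
        hres (hw2.const_mul α).neg
      have j2 := hres (hf2.const_mul (2 / α))
      have j3 := hres (hyI.const_mul c)
      have j4 : IntervalIntegrable (fun _ : ℝ => 4 * M ^ 2 / α * ‖u₀‖ ^ 2) volume 0 t :=
        intervalIntegrable_const
      have j5 : IntervalIntegrable (fun s => -(α * ‖w s‖ ^ 2) + 2 / α * ‖f s‖ ^ 2) volume 0 t :=
        j1.add j2
      have j6 : IntervalIntegrable (fun s => -(α * ‖w s‖ ^ 2) + 2 / α * ‖f s‖ ^ 2 +
        4 * M ^ 2 / α * ‖u₀‖ ^ 2) volume 0 t := j5.add j4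
      rw [intervalIntegral.integral_add j6 j3, intervalIntegral.integral_add j5 j4,
        intervalIntegral.integral_add j1 j2]
      simp only [intervalIntegral.integral_neg, intervalIntegral.integral_const_mul,
        intervalIntegral.integral_const, sub_zero, smul_eq_mul]
      ring
    have i4 : ∫ s in (0 : ℝ)..t, ‖f s‖ ^ 2 ≤ ‖f‖ ^ 2 := by
      rw [L2.norm_sq_eq]
      exact intervalIntegral_le_of_nonneg hf2 (fun s => by positivity) ht
    have i5 : t * (4 * M ^ 2 / α * ‖u₀‖ ^ 2) ≤ 4 * M ^ 2 * T / α * ‖u₀‖ ^ 2 := by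
      calc _ ≤ T * (4 * M ^ 2 / α * ‖u₀‖ ^ 2) := by gcongr; exact ht.2
        _ = _ := by ring
    have i6 : 2 / α * (∫ s in (0 : ℝ)..t, ‖f s‖ ^ 2) ≤ 2 / α * ‖f‖ ^ 2 := by gcongr
    have i7 := hqe t ht
    rw [hq0] at i7
    change ‖q t‖ ^ 2 + α * (∫ s in (0 : ℝ)..t, ‖w s‖ ^ 2) ≤ _
    linarith
  have hfin := le_mul_exp_of_le_integral hc0 hyc hy0 hint hTT
  have hyT : α * ‖w‖ ^ 2 ≤ y T := by
    rw [L2.norm_sq_eq, ← intervalIntegral_eq_setIntegral_Ioo hT.le]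
    exact le_add_of_nonneg_left (by positivity)
  set S := ‖u₀‖ + ‖u₁‖ + ‖f‖ with hS
  have hS0 : ‖u₀‖ ^ 2 ≤ S ^ 2 := by gcongr; rw [hS]; linarith [norm_nonneg u₁, norm_nonneg f]
  have hS1 : ‖u₁‖ ^ 2 ≤ S ^ 2 := by gcongr; rw [hS]; linarith [norm_nonneg u₀, norm_nonneg f]
  have hS2 : ‖f‖ ^ 2 ≤ S ^ 2 := by gcongr; rw [hS]; linarith [norm_nonneg u₀, norm_nonneg u₁]
  have hD : (‖u₁‖ ^ 2 + 2 / α * ‖f‖ ^ 2 + 4 * M ^ 2 * T / α * ‖u₀‖ ^ 2) * Real.exp (c * T) ≤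
      (1 + 2 / α + 4 * M ^ 2 * T / α) * S ^ 2 * Real.exp (c * T) := by
    gcongr
    calc _ ≤ S ^ 2 + 2 / α * S ^ 2 + 4 * M ^ 2 * T / α * S ^ 2 := by gcongr
      _ = _ := by ring
  rw [div_mul_eq_mul_div, le_div_iff₀ hα]
  linarith

/-- The maximal regularity estimate: the norm of `ü` in `L²(0,T;V')` is read off the equation. -/
theorem exists_normMR_le [CompleteSpace V] [CompleteSpace H] [IsScalarTower ℝ 𝕜 V]
    (hT : 0 < T) (hb : b.QuasiCoercive ι) :
    ∃ C : ℝ, 0 < C ∧ ∀ (u₀ : V) (u₁ : H) (f : L2 T (Antidual 𝕜 V)) (u : L2 T V),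
      IsSolution ι a b u₀ u₁ f u → normMR ι u ≤ C * (‖u₀‖ + ‖u₁‖ + ‖f‖) := by
  obtain ⟨K₁, hK₁, hw⟩ := exists_norm_weakDeriv_sq_le (a := a) hT hb
  obtain ⟨M, hM0, hM⟩ := a.exists_bound
  obtain ⟨N, hN0, hN⟩ := b.exists_bound
  set K₂ : ℝ := 2 * T + 2 * T ^ 2 * K₁ with hK₂
  set K₃ : ℝ := 3 * (1 + N ^ 2 * K₁ + M ^ 2 * K₂) with hK₃
  set e : ℝ := ‖embAntidual ι‖ with he
  have hK₂0 : 0 ≤ K₂ := by positivity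
  refine ⟨√(K₂ + K₁) + √(e ^ 2 * K₂ + e ^ 2 * K₁ + K₃) + 1, by positivity, fun u₀ u₁ f u h => ?_⟩
  have h1 := hw u₀ u₁ f u h
  set S := ‖u₀‖ + ‖u₁‖ + ‖f‖ with hS
  have hSpos : 0 ≤ S := by positivity
  have hS0 : ‖u₀‖ ^ 2 ≤ S ^ 2 := by gcongr; rw [hS]; linarith [norm_nonneg u₁, norm_nonneg f]
  have hS2 : ‖f‖ ^ 2 ≤ S ^ 2 := by gcongr; rw [hS]; linarith [norm_nonneg u₀, norm_nonneg u₁]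
  set w := weakDeriv u
  have h2 : ‖u‖ ^ 2 ≤ K₂ * S ^ 2 := by
    calc ‖u‖ ^ 2 = ∫ t in Ioo 0 T, ‖u t‖ ^ 2 := L2.norm_sq_eq u
      _ ≤ ∫ t in Ioo 0 T, (2 * ‖u₀‖ ^ 2 + 2 * (T * ‖w‖ ^ 2)) := by
        refine integral_mono_ae (L2.integrable_norm_sq u) (integrable_const _) ?_
        filter_upwards [h.ae_eq_primitive hT, ae_restrict_mem measurableSet_Ioo] with s hus hs
        have p1 : ‖u s‖ ≤ ‖u₀‖ + ‖∫ r in (0 : ℝ)..s, w r‖ := by rw [hus]; exact norm_add_le _ _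
        have p2 := L2.norm_primitive_sq_le w (Ioo_subset_Icc_self hs)
        nlinarith [sq_nonneg (‖u₀‖ - ‖∫ r in (0 : ℝ)..s, w r‖), norm_nonneg (u s)]
      _ = 2 * T * ‖u₀‖ ^ 2 + 2 * T ^ 2 * ‖w‖ ^ 2 := by simp [hT.le]; ring
      _ ≤ 2 * T * S ^ 2 + 2 * T ^ 2 * (K₁ * S ^ 2) := by gcongr
      _ = _ := by rw [hK₂]; ring
  set g := weakDeriv ((embAntidual ι).compLp w) with hg
  have h3 : ‖g‖ ^ 2 ≤ K₃ * S ^ 2 := by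
    have i1 := L2.integrable_norm_sq f
    have i2 := (L2.integrable_norm_sq w).const_mul (N ^ 2)
    have i3 := (L2.integrable_norm_sq u).const_mul (M ^ 2)
    calc ‖g‖ ^ 2 = ∫ t in Ioo 0 T, ‖g t‖ ^ 2 := L2.norm_sq_eq g
      _ ≤ ∫ t in Ioo 0 T, 3 * (‖f t‖ ^ 2 + N ^ 2 * ‖w t‖ ^ 2 + M ^ 2 * ‖u t‖ ^ 2) := by
        refine integral_mono_ae (L2.integrable_norm_sq g) (((i1.add i2).add i3).const_mul 3) ?_
        filter_upwards [h.equation, ae_restrict_mem measurableSet_Ioo] with s heq hs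
        have hs' := Ioo_subset_Icc_self hs
        have e1 := heq hs'
        rw [h.weakDeriv_emb] at e1
        have e2 : g s = f s - b.op s hs' (w s) - a.op s hs' (u s) := by
          rw [← e1]; abel
        have e3 : ‖g s‖ ≤ ‖f s‖ + N * ‖w s‖ + M * ‖u s‖ := by
          rw [e2]
          exact (norm_sub_le _ _).trans (add_le_add ((norm_sub_le _ _).trans (add_le_add le_rfl
            (NonautonomousForm.norm_op_apply_le hN0 hN s hs' _)))
            (NonautonomousForm.norm_op_apply_le hM0 hM s hs' _))
        have e4 : ‖g s‖ ^ 2 ≤ (‖f s‖ + N * ‖w s‖ + M * ‖u s‖) ^ 2 := by gcongr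
        nlinarith [sq_nonneg (‖f s‖ - N * ‖w s‖), sq_nonneg (‖f s‖ - M * ‖u s‖),
          sq_nonneg (N * ‖w s‖ - M * ‖u s‖)]
      _ = 3 * (‖f‖ ^ 2 + N ^ 2 * ‖w‖ ^ 2 + M ^ 2 * ‖u‖ ^ 2) := by
        rw [integral_const_mul, integral_add (i1.fun_add i2) i3, integral_add i1 i2,
          integral_const_mul, integral_const_mul, ← L2.norm_sq_eq, ← L2.norm_sq_eq, ← L2.norm_sq_eq]
      _ ≤ 3 * (S ^ 2 + N ^ 2 * (K₁ * S ^ 2) + M ^ 2 * (K₂ * S ^ 2)) := by gcongr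
      _ = _ := by rw [hK₃]; ring
  have hemb : ∀ {v : L2 T V} {K : ℝ}, ‖v‖ ^ 2 ≤ K * S ^ 2 →
      ‖(embAntidual ι).compLp v‖ ^ 2 ≤ e ^ 2 * K * S ^ 2 := fun {v K} hv => by
    calc _ ≤ (e * ‖v‖) ^ 2 := by gcongr; exact ContinuousLinearMap.norm_compLp_le _ _
      _ = e ^ 2 * ‖v‖ ^ 2 := mul_pow _ _ _
      _ ≤ e ^ 2 * (K * S ^ 2) := by gcongr
      _ = _ := by ring
  have h4 := hemb h2
  have h5 := hemb h1
  have hsqrt : ∀ {x K : ℝ}, x ≤ K * S ^ 2 → √x ≤ √K * S := fun {x K} hx => by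
    calc √x ≤ √(K * S ^ 2) := Real.sqrt_le_sqrt hx
      _ = √K * S := by rw [Real.sqrt_mul' _ (sq_nonneg S), Real.sqrt_sq hSpos]
  have h6 : normH1 u ≤ √(K₂ + K₁) * S := hsqrt (by rw [add_mul]; exact add_le_add h2 h1)
  have h7 : normH2 ((embAntidual ι).compLp u) ≤ √(e ^ 2 * K₂ + e ^ 2 * K₁ + K₃) * S := by
    rw [normH2, h.weakDeriv_emb]
    exact hsqrt (by rw [add_mul, add_mul]; exact add_le_add (add_le_add h4 h5) h3)
  calc normMR ι u ≤ √(K₂ + K₁) * S + √(e ^ 2 * K₂ + e ^ 2 * K₁ + K₃) * S := add_le_add h6 h7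
    _ ≤ _ := by nlinarith

theorem IsSolution.sub [CompleteSpace V] {u₀ v₀ : V} {u₁ v₁ : H}
    {f k : L2 T (Antidual 𝕜 V)} {u v : L2 T V}
    (h : IsSolution ι a b u₀ u₁ f u) (h' : IsSolution ι a b v₀ v₁ k v) :
    IsSolution ι a b (u₀ - v₀) (u₁ - v₁) (f - k) (u - v) := by
  have hc : ∀ p q : L2 T V, (embAntidual ι).compLp (p - q) =
      (embAntidual ι).compLp p - (embAntidual ι).compLp q := fun p q =>
    map_sub ((embAntidual ι).compLpₗ 2 (intervalMeasure T)) p q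
  have h1 := h.isWeakDeriv.sub h'.isWeakDeriv
  have h2 := h1.compLp (embAntidual ι)
  have h3 := h.isWeakDeriv_emb.sub h'.isWeakDeriv_emb
  rw [← hc] at h3
  have e1 : weakDeriv ((embAntidual ι).compLp (u - v)) =
      (embAntidual ι).compLp (weakDeriv u - weakDeriv v) := h2.weakDeriv_eq
  refine ⟨⟨⟨_, h1⟩, ⟨_, h2⟩, ?_⟩, ?_, h.initial.sub h'.initial (Lp.coeFn_sub _ _), ?_⟩
  · rw [e1]; exact ⟨_, h3⟩
  · rw [e1, h3.weakDeriv_eq, h1.weakDeriv_eq]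
    have q1 := h.equation
    have q2 := h'.equation
    rw [h.weakDeriv_emb] at q1
    rw [h'.weakDeriv_emb] at q2
    filter_upwards [q1, q2, Lp.coeFn_sub f k, Lp.coeFn_sub u v,
      Lp.coeFn_sub (weakDeriv u) (weakDeriv v),
      Lp.coeFn_sub (weakDeriv ((embAntidual ι).compLp (weakDeriv u)))
        (weakDeriv ((embAntidual ι).compLp (weakDeriv v)))] with t p1 p2 p3 p4 p5 p6 ht
    rw [p3, p4, p5, p6]
    simp only [Pi.sub_apply]
    rw [← p1 ht, ← p2 ht, map_sub, map_sub]
    abel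
  · rw [h1.weakDeriv_eq]
    refine h.initial_deriv.sub h'.initial_deriv ?_
    filter_upwards [ι.coeFn_compLp (weakDeriv u), ι.coeFn_compLp (weakDeriv v),
      ι.coeFn_compLp (weakDeriv u - weakDeriv v), Lp.coeFn_sub (weakDeriv u) (weakDeriv v)]
      with t p1 p2 p3 p4
    rw [p3, p4, Pi.sub_apply, Pi.sub_apply, p1, p2, map_sub]

theorem IsSolution.unique [CompleteSpace V] [CompleteSpace H] [IsScalarTower ℝ 𝕜 V] (hT : 0 < T)
    (hb : b.QuasiCoercive ι) {u₀ : V} {u₁ : H} {f : L2 T (Antidual 𝕜 V)} {u v : L2 T V}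
    (h : IsSolution ι a b u₀ u₁ f u) (h' : IsSolution ι a b u₀ u₁ f v) : u = v := by
  obtain ⟨C, -, hC⟩ := exists_normMR_le (a := a) hT hb
  have h1 := hC _ _ _ _ (h.sub h')
  simp only [sub_self, norm_zero, add_zero, mul_zero] at h1
  have h2 : ‖u - v‖ ≤ normMR ι (u - v) := by
    refine le_add_of_le_of_nonneg (Real.le_sqrt_of_sq_le ?_) (Real.sqrt_nonneg _)
    exact le_add_of_nonneg_right (sq_nonneg _)
  exact sub_eq_zero.1 (norm_le_zero_iff.1 (h2.trans h1))

end Estimate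

/-! ### Lions' representation theorem -/

/-- Lions' representation theorem in the form used here: if the functional `L` is dominated by the
operator `S`, with values in a Hilbert space, then `L φ = ⟪w, S φ⟫` for some `w`. -/
theorem exists_inner_eq_of_norm_le {𝕜 W X : Type*} [RCLike 𝕜] [AddCommGroup W] [Module 𝕜 W]
    [NormedAddCommGroup X] [InnerProductSpace 𝕜 X] [CompleteSpace X] (S : W →ₗ[𝕜] X)
    (L : W →ₗ[𝕜] 𝕜) (C : ℝ) (h : ∀ φ, ‖L φ‖ ≤ C * ‖S φ‖) :
    ∃ w : X, ∀ φ, inner 𝕜 w (S φ) = L φ := by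
  have hker : L ∈ (LinearMap.ker S).dualAnnihilator := by
    rw [Submodule.mem_dualAnnihilator]
    intro φ hφ
    have := h φ
    rw [LinearMap.mem_ker.1 hφ, norm_zero, mul_zero] at this
    exact norm_le_zero_iff.1 this
  rw [← LinearMap.range_dualMap_eq_dualAnnihilator_ker] at hker
  obtain ⟨ℓ, hℓ⟩ := hker
  have hℓ' : ∀ φ, ℓ (S φ) = L φ := fun φ => by rw [← hℓ]; rfl
  let p : StrongDual 𝕜 (LinearMap.range S) :=
    (ℓ.comp (LinearMap.range S).subtype).mkContinuous C (by
      rintro ⟨_, φ, rfl⟩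
      change ‖ℓ (S φ)‖ ≤ C * ‖S φ‖
      rw [hℓ']
      exact h φ)
  obtain ⟨q, hq, -⟩ := exists_extension_norm_eq (LinearMap.range S) p
  refine ⟨(InnerProductSpace.toDual 𝕜 X).symm q, fun φ => ?_⟩
  rw [InnerProductSpace.toDual_symm_apply, ← hℓ']
  exact hq ⟨S φ, φ, rfl⟩

/-! ### The operators associated with a non-autonomous form on `L²(0,T;V)` -/

section Operators

variable {𝕜 V H : Type*} [RCLike 𝕜]
  [NormedAddCommGroup V] [InnerProductSpace 𝕜 V]
  [NormedAddCommGroup H] [InnerProductSpace 𝕜 H] {T : ℝ}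

variable (𝕜 V) in
/-- The Riesz isomorphism `V ≃ V'`, linear because `V'` consists of antilinear functionals. -/
def rieszAntidual [CompleteSpace V] : V ≃ₗᵢ[𝕜] Antidual 𝕜 V :=
  LinearIsometryEquiv.ofSurjective
    { toLinearMap := (toAntidual (ContinuousLinearMap.id 𝕜 V) : V →ₗ[𝕜] Antidual 𝕜 V)
      norm_map' := fun v => by
        refine le_antisymm (ContinuousLinearMap.opNorm_le_bound _ (norm_nonneg _) fun x => ?_) ?_
        · rw [mul_comm]
          exact norm_inner_le_norm x v
        · have h : ‖inner 𝕜 v v‖ ≤ ‖toAntidual (ContinuousLinearMap.id 𝕜 V) v‖ * ‖v‖ :=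
            (toAntidual (ContinuousLinearMap.id 𝕜 V) v).le_opNorm v
          rw [inner_self_eq_norm_sq_to_K, norm_pow, RCLike.norm_ofReal, abs_norm, pow_two] at h
          rcases (norm_nonneg v).eq_or_lt with h0 | h0
          · rw [← h0]; exact norm_nonneg _
          · exact le_of_mul_le_mul_right h h0 }
    (fun ℓ => by
      refine ⟨(InnerProductSpace.toDual 𝕜 V).symm
        (((starL 𝕜 : 𝕜 ≃L⋆[𝕜] 𝕜) : 𝕜 →L⋆[𝕜] 𝕜).comp ℓ), ?_⟩
      ext x
      change inner 𝕜 x _ = ℓ x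
      rw [← inner_conj_symm, InnerProductSpace.toDual_symm_apply]
      simp)

theorem rieszAntidual_apply [CompleteSpace V] (v x : V) :
    rieszAntidual 𝕜 V v x = inner 𝕜 x v := rfl

/-- Pettis' theorem in a separable Hilbert space: weak measurability implies measurability. The
inner products with a dense sequence embed the space measurably into a space of sequences. -/
theorem aestronglyMeasurable_of_inner [CompleteSpace V] [TopologicalSpace.SeparableSpace V]
    {α : Type*} [MeasurableSpace α] {μ : Measure α} {f : α → V}
    (h : ∀ v : V, AEMeasurable (fun t => inner 𝕜 v (f t)) μ) : AEStronglyMeasurable f μ := by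
  borelize V
  have : SecondCountableTopology V := UniformSpace.secondCountable_of_separable V
  let Φ : V → ℕ → 𝕜 := fun x n => inner 𝕜 (TopologicalSpace.denseSeq V n) x
  have hΦc : Continuous Φ := by fun_prop
  have hΦi : Function.Injective Φ := by
    intro x y hxy
    have h1 : ∀ v : V, inner 𝕜 v x = inner 𝕜 v y := by
      intro v
      refine (TopologicalSpace.denseRange_denseSeq V).induction_on v
        (isClosed_eq (by fun_prop) (by fun_prop)) fun n => congrFun hxy n
    exact ext_inner_left 𝕜 h1
  have h2 : AEMeasurable (Φ ∘ f) μ := aemeasurable_pi_lambda _ fun n => h _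
  exact ((hΦc.measurableEmbedding hΦi).aemeasurable_comp_iff.1 h2).aestronglyMeasurable

open Classical in
/-- The bounded operator on `V` that represents the form `a(t,·,·)` with respect to the inner
product of `V`; it is set to `0` for `t ∉ [0,T]`. -/
def NonautonomousForm.repr [CompleteSpace V] (a : NonautonomousForm 𝕜 V T) (t : ℝ) : V →L[𝕜] V :=
  if ht : t ∈ Icc 0 T then
    ((rieszAntidual 𝕜 V).symm.toContinuousLinearEquiv : Antidual 𝕜 V →L[𝕜] V).comp (a.op t ht)
  else 0

theorem NonautonomousForm.riesz_repr [CompleteSpace V] (a : NonautonomousForm 𝕜 V T) {t : ℝ}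
    (ht : t ∈ Icc 0 T) (u : V) : rieszAntidual 𝕜 V (a.repr t u) = a.op t ht u := by
  rw [NonautonomousForm.repr, dif_pos ht]
  exact (rieszAntidual 𝕜 V).apply_symm_apply _

theorem NonautonomousForm.inner_repr [CompleteSpace V] (a : NonautonomousForm 𝕜 V T) {t : ℝ}
    (ht : t ∈ Icc 0 T) (u v : V) : inner 𝕜 v (a.repr t u) = a.form t u v := by
  rw [← rieszAntidual_apply, a.riesz_repr ht]
  rfl

theorem NonautonomousForm.norm_repr_le [CompleteSpace V] {a : NonautonomousForm 𝕜 V T} {M : ℝ}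
    (hM0 : 0 ≤ M) (hM : ∀ t ∈ Icc 0 T, ∀ u v : V, ‖a.form t u v‖ ≤ M * ‖u‖ * ‖v‖) {t : ℝ}
    (ht : t ∈ Icc 0 T) (u : V) : ‖a.repr t u‖ ≤ M * ‖u‖ := by
  rw [← (rieszAntidual 𝕜 V).norm_map, a.riesz_repr ht]
  exact NonautonomousForm.norm_op_apply_le hM0 hM t ht u

variable [CompleteSpace V] [TopologicalSpace.SeparableSpace V]

/-- Weak measurability of `t ↦ a(t)* v` is the measurability of the form. By Pettis' theorem this
curve is measurable, which then gives the weak measurability of `t ↦ a(t) w(t)`. -/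
theorem NonautonomousForm.aestronglyMeasurable_repr (a : NonautonomousForm 𝕜 V T) {w : ℝ → V}
    (hw : AEStronglyMeasurable w (intervalMeasure T)) :
    AEStronglyMeasurable (fun t => a.repr t (w t)) (intervalMeasure T) := by
  have hadj : ∀ v : V, AEStronglyMeasurable (fun t => ContinuousLinearMap.adjoint (a.repr t) v)
      (intervalMeasure T) := by
    intro v
    refine aestronglyMeasurable_of_inner (𝕜 := 𝕜) fun u => ?_
    have h1 : AEMeasurable (fun t => starRingEnd 𝕜 (a.form t u v)) (intervalMeasure T) :=
      RCLike.continuous_conj.measurable.comp_aemeasurable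
        ((a.measurable u v).mono_measure (Measure.restrict_mono Ioo_subset_Icc_self le_rfl))
    refine h1.congr ?_
    filter_upwards [ae_restrict_mem measurableSet_Ioo] with t ht
    rw [ContinuousLinearMap.adjoint_inner_right, ← inner_conj_symm,
      a.inner_repr (Ioo_subset_Icc_self ht)]
  refine aestronglyMeasurable_of_inner (𝕜 := 𝕜) fun v => ?_
  have h2 : (fun t => inner 𝕜 v (a.repr t (w t))) =
      fun t => inner 𝕜 (ContinuousLinearMap.adjoint (a.repr t) v) (w t) := by
    ext t
    rw [ContinuousLinearMap.adjoint_inner_left]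
  rw [h2]
  exact ((hadj v).inner hw).aemeasurable

theorem NonautonomousForm.memLp_repr (a : NonautonomousForm 𝕜 V T) (w : L2 T V) :
    MemLp (fun t => a.repr t (w t)) 2 (intervalMeasure T) := by
  obtain ⟨M, hM0, hM⟩ := a.exists_bound
  refine (Lp.memLp w).of_le_mul (c := M)
    (a.aestronglyMeasurable_repr (Lp.aestronglyMeasurable w)) ?_
  filter_upwards [ae_restrict_mem measurableSet_Ioo] with t ht
  exact NonautonomousForm.norm_repr_le hM0 hM (Ioo_subset_Icc_self ht) _

/-- The bounded operator on `L²(0,T;V)` induced by a non-autonomous form. -/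
def NonautonomousForm.opL2 (a : NonautonomousForm 𝕜 V T) : L2 T V →L[𝕜] L2 T V :=
  LinearMap.mkContinuousOfExistsBound
    { toFun := fun w => (a.memLp_repr w).toLp _
      map_add' := fun u w => by
        rw [← MemLp.toLp_add, MemLp.toLp_eq_toLp_iff]
        filter_upwards [Lp.coeFn_add u w] with t ht
        rw [ht, Pi.add_apply, Pi.add_apply, map_add]
      map_smul' := fun c w => by
        rw [RingHom.id_apply, ← MemLp.toLp_const_smul, MemLp.toLp_eq_toLp_iff]
        filter_upwards [Lp.coeFn_smul c w] with t ht
        rw [ht, Pi.smul_apply, Pi.smul_apply, map_smul] }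
    (by
      obtain ⟨M, hM0, hM⟩ := a.exists_bound
      refine ⟨M, fun w => Lp.norm_le_mul_norm_of_ae_le_mul ?_⟩
      filter_upwards [(a.memLp_repr w).coeFn_toLp, ae_restrict_mem measurableSet_Ioo] with t h1 ht
      change ‖((a.memLp_repr w).toLp _) t‖ ≤ _
      rw [h1]
      exact NonautonomousForm.norm_repr_le hM0 hM (Ioo_subset_Icc_self ht) _)

theorem NonautonomousForm.coeFn_opL2 (a : NonautonomousForm 𝕜 V T) (w : L2 T V) :
    a.opL2 w =ᵐ[intervalMeasure T] fun t => a.repr t (w t) := (a.memLp_repr w).coeFn_toLp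

end Operators

/-! ### Test functions and coercivity -/

theorem memLp_of_continuous {E : Type*} [NormedAddCommGroup E] {T : ℝ} {f : ℝ → E}
    (hf : Continuous f) : MemLp f 2 (intervalMeasure T) := by
  obtain ⟨C, hC⟩ := isCompact_Icc.exists_bound_of_continuousOn (s := Icc 0 T) hf.continuousOn
  have hs : AEStronglyMeasurable f (intervalMeasure T) :=
    (hf.continuousOn (s := Icc 0 T)).aestronglyMeasurable_of_isCompact isCompact_Icc
      measurableSet_Icc |>.mono_measure (Measure.restrict_mono Ioo_subset_Icc_self le_rfl)
  refine MemLp.of_bound hs C ?_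
  filter_upwards [ae_restrict_mem measurableSet_Ioo] with t ht
  exact hC t (Ioo_subset_Icc_self ht)

section Test

variable {𝕜 V H : Type*} [RCLike 𝕜]
  [NormedAddCommGroup V] [InnerProductSpace 𝕜 V] [NormedSpace ℝ V] [IsScalarTower ℝ 𝕜 V]
  [NormedAddCommGroup H] [InnerProductSpace 𝕜 H] {T : ℝ}

variable (𝕜 V T) in
/-- The test functions: continuously differentiable functions with values in `V` that vanish
at `T`. -/
def testFunctions : Submodule 𝕜 (ℝ → V) where
  carrier := {φ | ContDiff ℝ 1 φ ∧ φ T = 0}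
  add_mem' := fun {φ ψ} hφ hψ => ⟨hφ.1.add hψ.1, by simp [hφ.2, hψ.2]⟩
  zero_mem' := ⟨contDiff_const, rfl⟩
  smul_mem' := fun c φ hφ => ⟨hφ.1.const_smul c, by simp [hφ.2]⟩

variable (𝕜 V T) in
/-- The class of a test function in `L²(0,T;V)`. -/
def testToL2 : testFunctions 𝕜 V T →ₗ[𝕜] L2 T V where
  toFun φ := (memLp_of_continuous φ.2.1.continuous).toLp φ.1
  map_add' _ _ := rfl
  map_smul' _ _ := rfl

variable (𝕜 V T) in
/-- The class of the derivative of a test function in `L²(0,T;V)`. -/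
def testDeriv : testFunctions 𝕜 V T →ₗ[𝕜] L2 T V where
  toFun φ := (memLp_of_continuous (φ.2.1.continuous_deriv le_rfl)).toLp (deriv φ.1)
  map_add' φ ψ := by
    rw [← MemLp.toLp_add, MemLp.toLp_eq_toLp_iff]
    exact Eventually.of_forall fun t => deriv_add
      (φ.2.1.differentiable one_ne_zero).differentiableAt
      (ψ.2.1.differentiable one_ne_zero).differentiableAt
  map_smul' c φ := by
    rw [RingHom.id_apply, ← MemLp.toLp_const_smul, MemLp.toLp_eq_toLp_iff]
    exact Eventually.of_forall fun t => deriv_const_smul c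
      (φ.2.1.differentiable one_ne_zero).differentiableAt

theorem coeFn_testToL2 (φ : testFunctions 𝕜 V T) :
    testToL2 𝕜 V T φ =ᵐ[intervalMeasure T] φ.1 :=
  (memLp_of_continuous φ.2.1.continuous).coeFn_toLp

theorem coeFn_testDeriv (φ : testFunctions 𝕜 V T) :
    testDeriv 𝕜 V T φ =ᵐ[intervalMeasure T] deriv φ.1 :=
  (memLp_of_continuous (φ.2.1.continuous_deriv le_rfl)).coeFn_toLp

variable [CompleteSpace V] [TopologicalSpace.SeparableSpace V] [CompleteSpace H]

/-- The operator `w ↦ B w + A ∫₀ᵗ w` on `L²(0,T;V)`, where `A` and `B` are represented by operators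
on `V`. -/
def memoryOp (a b : NonautonomousForm 𝕜 V T) (hT : 0 < T) : L2 T V →L[𝕜] L2 T V :=
  b.opL2 + a.opL2.comp (volterra V 𝕜 hT)

/-- The formal adjoint of `w ↦ ẇ + B w + A ∫₀ᵗ w` on test functions, taken in `L²(0,T;V)`. -/
def adjointOp (ι : V →L[𝕜] H) (a b : NonautonomousForm 𝕜 V T) (hT : 0 < T) :
    testFunctions 𝕜 V T →ₗ[𝕜] L2 T V :=
  (ContinuousLinearMap.adjoint (memoryOp a b hT) : L2 T V →ₗ[𝕜] L2 T V) ∘ₗ testToL2 𝕜 V T -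
    (((ContinuousLinearMap.adjoint ι).comp ι).compLpL 2 (intervalMeasure T) :
      L2 T V →ₗ[𝕜] L2 T V) ∘ₗ testDeriv 𝕜 V T

theorem inner_adjointOp (ι : V →L[𝕜] H) (a b : NonautonomousForm 𝕜 V T) (hT : 0 < T)
    (w : L2 T V) (φ : testFunctions 𝕜 V T) :
    inner 𝕜 w (adjointOp ι a b hT φ) = inner 𝕜 (memoryOp a b hT w) (testToL2 𝕜 V T φ) -
      inner 𝕜 w (((ContinuousLinearMap.adjoint ι).comp ι).compLp (testDeriv 𝕜 V T φ)) := by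
  rw [adjointOp, LinearMap.sub_apply, inner_sub_right, ← ContinuousLinearMap.adjoint_inner_right]
  rfl

end Test

section Coercivity

variable {𝕜 V H : Type*} [RCLike 𝕜]
  [NormedAddCommGroup V] [InnerProductSpace 𝕜 V] [NormedSpace ℝ V]
  [NormedAddCommGroup H] [InnerProductSpace 𝕜 H] {T : ℝ}

theorem re_inner_real_smul_left [IsScalarTower ℝ 𝕜 V] (r : ℝ) (x y : V) :
    RCLike.re (inner 𝕜 (r • x) y) = r * RCLike.re (inner 𝕜 x y) := by
  rw [RCLike.real_smul_eq_coe_smul (K := 𝕜), inner_smul_real_left, RCLike.smul_re]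

/-- The weighted Cauchy–Schwarz inequality that makes the memory term small for large `r`. -/
theorem norm_primitive_exp_smul_sq_le {r : ℝ} (hr : 0 < r) {φ : ℝ → V} (hφ : Continuous φ) {t : ℝ}
    (ht : t ∈ Icc 0 T) :
    ‖∫ s in (0 : ℝ)..t, Real.exp (2 * r * s) • φ s‖ ^ 2 ≤
      Real.exp (2 * r * t) / (2 * r) * ∫ s in (0 : ℝ)..T, Real.exp (2 * r * s) * ‖φ s‖ ^ 2 := by
  have hsq : ∀ s : ℝ, Real.exp (2 * r * s) = Real.exp (r * s) * Real.exp (r * s) := fun s => by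
    rw [← Real.exp_add]; ring_nf
  have h1 : ‖∫ s in (0 : ℝ)..t, Real.exp (2 * r * s) • φ s‖ ≤
      ∫ s in Ioo 0 t, Real.exp (r * s) * (Real.exp (r * s) * ‖φ s‖) := by
    rw [← intervalIntegral_eq_setIntegral_Ioo ht.1]
    refine (intervalIntegral.norm_integral_le_integral_norm ht.1).trans_eq ?_
    congr 1
    ext s
    rw [norm_smul, Real.norm_of_nonneg (Real.exp_nonneg _), hsq, mul_assoc]
  have h2 := integral_mul_sq_le (μ := intervalMeasure t)
    (memLp_of_continuous (by fun_prop : Continuous fun s => Real.exp (r * s)))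
    (memLp_of_continuous (by fun_prop : Continuous fun s => Real.exp (r * s) * ‖φ s‖))
  have h3 : ∫ s in Ioo 0 t, Real.exp (r * s) ^ 2 ≤ Real.exp (2 * r * t) / (2 * r) := by
    have hd : ∀ s : ℝ, HasDerivAt (fun s => Real.exp (2 * r * s) / (2 * r))
        (Real.exp (r * s) ^ 2) s := by
      intro s
      have := (((hasDerivAt_id s).const_mul (2 * r)).exp).div_const (2 * r)
      refine this.congr_deriv ?_
      rw [pow_two, ← hsq, mul_one, mul_div_cancel_right₀ _ (by positivity)]
      rfl
    rw [← intervalIntegral_eq_setIntegral_Ioo ht.1,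
      intervalIntegral.integral_eq_sub_of_hasDerivAt (fun s _ => hd s)
        (Continuous.intervalIntegrable (by fun_prop) _ _)]
    have : 0 < Real.exp (2 * r * 0) / (2 * r) := by positivity
    linarith
  have h4 : ∫ s in Ioo 0 t, (Real.exp (r * s) * ‖φ s‖) ^ 2 ≤
      ∫ s in (0 : ℝ)..T, Real.exp (2 * r * s) * ‖φ s‖ ^ 2 := by
    have e : ∀ s, (Real.exp (r * s) * ‖φ s‖) ^ 2 = Real.exp (2 * r * s) * ‖φ s‖ ^ 2 := fun s => by
      rw [hsq]; ring
    simp only [e]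
    rw [← intervalIntegral_eq_setIntegral_Ioo ht.1,
      intervalIntegral_eq_setIntegral_Ioo (ht.1.trans ht.2)]
    refine intervalIntegral_le_of_nonneg ?_ (fun s => by positivity) ht
    exact ((by fun_prop : Continuous fun s => Real.exp (2 * r * s) * ‖φ s‖ ^ 2).integrableOn_Icc
      (a := 0) (b := T)).mono_set Ioo_subset_Icc_self
  calc _ ≤ (∫ s in Ioo 0 t, Real.exp (r * s) * (Real.exp (r * s) * ‖φ s‖)) ^ 2 := by gcongr
    _ ≤ _ := h2
    _ ≤ _ := mul_le_mul h3 h4 (integral_nonneg fun s => by positivity) (by positivity)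

theorem integral_deriv_exp_mul_norm_sq (ι : V →L[𝕜] H) (r : ℝ) {φ : ℝ → V} (hφ : ContDiff ℝ 1 φ) :
    ∫ t in (0 : ℝ)..T, Real.exp (2 * r * t) * (2 * r * ‖ι (φ t)‖ ^ 2 +
        2 * RCLike.re (inner 𝕜 (ι (φ t)) (ι (deriv φ t)))) =
      Real.exp (2 * r * T) * ‖ι (φ T)‖ ^ 2 - ‖ι (φ 0)‖ ^ 2 := by
  let _ := InnerProductSpace.rclikeToReal 𝕜 H
  have hd : ∀ s, HasDerivAt (fun s => ι (φ s)) (ι (deriv φ s)) s := fun s =>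
    ((ι : V →+ H).toRealLinearMap ι.continuous).hasFDerivAt.comp_hasDerivAt s
      ((hφ.differentiable one_ne_zero).differentiableAt.hasDerivAt)
  have hc := hφ.continuous
  have hdc := hφ.continuous_deriv le_rfl
  have hd2 : ∀ s, HasDerivAt (fun t => Real.exp (2 * r * t) * ‖ι (φ t)‖ ^ 2)
      (Real.exp (2 * r * s) * (2 * r * ‖ι (φ s)‖ ^ 2 +
        2 * RCLike.re (inner 𝕜 (ι (φ s)) (ι (deriv φ s))))) s := by
    intro s
    have h1 : HasDerivAt (fun t => Real.exp (2 * r * t)) (Real.exp (2 * r * s) * (2 * r * 1)) s :=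
      ((hasDerivAt_id s).const_mul (2 * r)).exp
    refine (h1.mul (hd s).norm_sq).congr_deriv ?_
    rw [real_inner_eq_re_inner 𝕜]
    ring
  rw [intervalIntegral.integral_eq_sub_of_hasDerivAt (fun s _ => hd2 s)
    (Continuous.intervalIntegrable (by fun_prop) _ _)]
  simp

variable [IsScalarTower ℝ 𝕜 V] [CompleteSpace V] [TopologicalSpace.SeparableSpace V]
  [CompleteSpace H] {ι : V →L[𝕜] H} {a b : NonautonomousForm 𝕜 V T}

/-- Coercivity: testing the adjoint problem with `t ↦ exp (2 r t) φ(t)`, for `r` large, bounds the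
test function `φ` and its initial value. -/
theorem exists_norm_le_adjointOp (hT : 0 < T) (hb : b.QuasiCoercive ι) :
    ∃ C : ℝ, 0 ≤ C ∧ ∀ φ : testFunctions 𝕜 V T,
      ‖testToL2 𝕜 V T φ‖ ≤ C * ‖adjointOp ι a b hT φ‖ ∧
      ‖ι (φ.1 0)‖ ≤ C * ‖adjointOp ι a b hT φ‖ := by
  obtain ⟨M, hM0, hM⟩ := a.exists_bound
  obtain ⟨α, hα, κ, hκ⟩ := hb
  -- The rate `r` dominates `κ`, and keeps the memory term below a quarter of the coercivity.
  set r : ℝ := |κ| + 2 * M ^ 2 * T / α ^ 2 + 1 with hr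
  have hr0 : 0 < r := by positivity
  have hrκ : κ ≤ r := by
    have : 0 ≤ 2 * M ^ 2 * T / α ^ 2 := by positivity
    linarith [le_abs_self κ]
  have hrM : T * (M ^ 2 / (2 * α * r)) ≤ α / 4 := by
    have h1 : 2 * M ^ 2 * T / α ^ 2 ≤ r := by linarith [abs_nonneg κ]
    rw [div_le_iff₀ (by positivity)] at h1
    rw [← mul_div_assoc, div_le_iff₀ (by positivity)]
    nlinarith
  set m : ℝ → ℝ := fun t => Real.exp (2 * r * t) with hm
  have hmc : Continuous m := by fun_prop
  have hm0 : ∀ t, 0 < m t := fun t => Real.exp_pos _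
  set μ := m T with hμ
  have hμ0 : 0 < μ := hm0 T
  have key : ∀ φ : testFunctions 𝕜 V T,
      α / 2 * ‖testToL2 𝕜 V T φ‖ ^ 2 + 1 / 2 * ‖ι (φ.1 0)‖ ^ 2 ≤
        μ * (‖testToL2 𝕜 V T φ‖ * ‖adjointOp ι a b hT φ‖) := by
    intro φ
    have hφ1 : ContDiff ℝ 1 φ.1 := φ.2.1
    have hφc := hφ1.continuous
    have hφd := hφ1.continuous_deriv le_rfl
    have hPc : Continuous fun t => m t • φ.1 t := by fun_prop
    set P : L2 T V := (memLp_of_continuous hPc).toLp _ with hP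
    have hPe : P =ᵐ[intervalMeasure T] fun t => m t • φ.1 t := MemLp.coeFn_toLp _
    set Φ := testToL2 𝕜 V T φ with hΦ
    set Ψ := ((ContinuousLinearMap.adjoint ι).comp ι).compLp (testDeriv 𝕜 V T φ) with hΨ
    set Q : ℝ := ∫ t in (0 : ℝ)..T, m t * ‖φ.1 t‖ ^ 2 with hQ
    set E' : ℝ → ℝ := fun t => m t * (2 * r * ‖ι (φ.1 t)‖ ^ 2 +
        2 * RCLike.re (inner 𝕜 (ι (φ.1 t)) (ι (deriv φ.1 t)))) with hE'
    have hE'c : Continuous E' := by fun_prop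
    -- The pointwise lower bound for the integrand of `⟪P, S φ⟫`.
    have hpt : ∀ᵐ t ∂intervalMeasure T,
        3 * α / 4 * (m t * ‖φ.1 t‖ ^ 2) - M ^ 2 / (2 * α * r) * Q - 1 / 2 * E' t ≤
          RCLike.re (inner 𝕜 (memoryOp a b hT P t) (Φ t) - inner 𝕜 (P t) (Ψ t)) := by
      filter_upwards [hPe, coeFn_testToL2 φ, coeFn_testDeriv φ,
        ContinuousLinearMap.coeFn_compLp ((ContinuousLinearMap.adjoint ι).comp ι)
          (testDeriv 𝕜 V T φ), Lp.coeFn_add (b.opL2 P) (a.opL2 (volterra V 𝕜 hT P)),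
        b.coeFn_opL2 P, a.coeFn_opL2 (volterra V 𝕜 hT P), coeFn_volterra 𝕜 hT P,
        ae_restrict_mem measurableSet_Ioo] with t e1 e2 e3 e4 e5 e6 e7 e8 ht
      have ht' := Ioo_subset_Icc_self ht
      have e9 : ∫ s in (0 : ℝ)..t, P s = ∫ s in (0 : ℝ)..t, m s • φ.1 s :=
        integral_congr_Ioo ht' hPe
      have e10 : memoryOp a b hT P t = b.repr t (m t • φ.1 t) +
          a.repr t (∫ s in (0 : ℝ)..t, m s • φ.1 s) := by
        rw [← e9, ← e8, ← e1, ← e6, ← e7]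
        exact e5
      set A := ∫ s in (0 : ℝ)..t, m s • φ.1 s with hA
      have f1 : RCLike.re (inner 𝕜 (b.repr t (m t • φ.1 t)) (φ.1 t)) =
          m t * RCLike.re (b.form t (φ.1 t) (φ.1 t)) := by
        rw [map_real_smul (b.repr t) (b.repr t).continuous, re_inner_real_smul_left, inner_re_symm,
          b.inner_repr ht']
      have f2 : -(M * ‖A‖ * ‖φ.1 t‖) ≤ RCLike.re (inner 𝕜 (a.repr t A) (φ.1 t)) := by
        have h1 : ‖inner 𝕜 (a.repr t A) (φ.1 t)‖ ≤ M * ‖A‖ * ‖φ.1 t‖ :=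
          (norm_inner_le_norm _ _).trans
            (mul_le_mul_of_nonneg_right (NonautonomousForm.norm_repr_le hM0 hM ht' A)
              (norm_nonneg _))
        have h2 := (abs_le.1 (RCLike.abs_re_le_norm (inner 𝕜 (a.repr t A) (φ.1 t)))).1
        linarith
      have f3 : RCLike.re (inner 𝕜 (P t) (Ψ t)) =
          m t * RCLike.re (inner 𝕜 (ι (φ.1 t)) (ι (deriv φ.1 t))) := by
        rw [e1, e4, e3, re_inner_real_smul_left]
        congr 2
        exact ContinuousLinearMap.adjoint_inner_right ι _ _
      have f4 : ‖A‖ ^ 2 ≤ m t / (2 * r) * Q := norm_primitive_exp_smul_sq_le hr0 hφc ht'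
      have f5 : M * ‖A‖ * ‖φ.1 t‖ ≤ α / 4 * (m t * ‖φ.1 t‖ ^ 2) + M ^ 2 / (2 * α * r) * Q := by
        have h1 : M ^ 2 / (α * m t) * ‖A‖ ^ 2 ≤ M ^ 2 / (2 * α * r) * Q := by
          calc _ ≤ M ^ 2 / (α * m t) * (m t / (2 * r) * Q) := by
                have := hm0 t
                gcongr
            _ = _ := by have := (hm0 t).ne'; field_simp
        have h2 : α / 4 * (m t * ‖φ.1 t‖ ^ 2) + M ^ 2 / (α * m t) * ‖A‖ ^ 2 - M * ‖A‖ * ‖φ.1 t‖ =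
            (α * m t * ‖φ.1 t‖ - 2 * (M * ‖A‖)) ^ 2 / (4 * (α * m t)) := by
          have := (hm0 t).ne'; field_simp; ring
        have h3 : 0 ≤ (α * m t * ‖φ.1 t‖ - 2 * (M * ‖A‖)) ^ 2 / (4 * (α * m t)) := by
          have := hm0 t; positivity
        linarith
      have f6 : m t * (α * ‖φ.1 t‖ ^ 2 - r * ‖ι (φ.1 t)‖ ^ 2) ≤
          m t * RCLike.re (b.form t (φ.1 t) (φ.1 t)) := by
        refine mul_le_mul_of_nonneg_left ?_ (hm0 t).le
        have := hκ t ht' (φ.1 t)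
        have h1 : κ * ‖ι (φ.1 t)‖ ^ 2 ≤ r * ‖ι (φ.1 t)‖ ^ 2 := by gcongr
        linarith
      rw [map_sub, f3, e10, e2, inner_add_left, map_add, f1]
      have f7 : E' t = m t * (2 * r * ‖ι (φ.1 t)‖ ^ 2 +
        2 * RCLike.re (inner 𝕜 (ι (φ.1 t)) (ι (deriv φ.1 t)))) := rfl
      rw [f7]
      linarith
    have hI1 : Integrable (fun t => inner 𝕜 (memoryOp a b hT P t) (Φ t)) (intervalMeasure T) :=
      L2.integrable_inner _ _
    have hI2 : Integrable (fun t => inner 𝕜 (P t) (Ψ t)) (intervalMeasure T) :=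
      L2.integrable_inner _ _
    have hre : RCLike.re (inner 𝕜 P (adjointOp ι a b hT φ)) = ∫ t in Ioo 0 T,
        RCLike.re (inner 𝕜 (memoryOp a b hT P t) (Φ t) - inner 𝕜 (P t) (Ψ t)) := by
      rw [inner_adjointOp, L2.inner_def, L2.inner_def, ← integral_sub hI1 hI2]
      exact (integral_re (hI1.sub hI2)).symm
    have hcI : ∀ {k : ℝ → ℝ}, Continuous k → Integrable k (intervalMeasure T) := fun hk =>
      (hk.integrableOn_Icc (a := 0) (b := T)).mono_set Ioo_subset_Icc_self
    have hmφ : Continuous fun t => m t * ‖φ.1 t‖ ^ 2 := by fun_prop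
    have hlow : ∫ t in Ioo 0 T, (3 * α / 4 * (m t * ‖φ.1 t‖ ^ 2) - M ^ 2 / (2 * α * r) * Q -
        1 / 2 * E' t) ≤ RCLike.re (inner 𝕜 P (adjointOp ι a b hT φ)) := by
      rw [hre]
      exact integral_mono_ae (hcI (by fun_prop)) (hI1.sub hI2).re hpt
    have hval : ∫ t in Ioo 0 T, (3 * α / 4 * (m t * ‖φ.1 t‖ ^ 2) - M ^ 2 / (2 * α * r) * Q -
        1 / 2 * E' t) =
          3 * α / 4 * Q - T * (M ^ 2 / (2 * α * r)) * Q + 1 / 2 * ‖ι (φ.1 0)‖ ^ 2 := by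
      have h1 : ∫ t in (0 : ℝ)..T, E' t = - ‖ι (φ.1 0)‖ ^ 2 := by
        have := integral_deriv_exp_mul_norm_sq (T := T) ι r hφ1
        rw [φ.2.2, map_zero, norm_zero] at this
        rw [hE', hm, this]
        ring
      rw [← intervalIntegral_eq_setIntegral_Ioo hT.le, intervalIntegral.integral_sub
        (Continuous.intervalIntegrable (by fun_prop) _ _)
        (Continuous.intervalIntegrable (by fun_prop) _ _), intervalIntegral.integral_sub
        (Continuous.intervalIntegrable (by fun_prop) _ _)
        (Continuous.intervalIntegrable (by fun_prop) _ _), intervalIntegral.integral_const_mul,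
        intervalIntegral.integral_const_mul, intervalIntegral.integral_const,
        intervalIntegral.integral_const_mul, h1, ← hQ, smul_eq_mul]
      ring
    have hm1 : ∀ t ∈ Icc 0 T, 1 ≤ m t := fun t ht =>
      Real.one_le_exp (by have := ht.1; positivity)
    have hmT : ∀ t ∈ Icc 0 T, m t ≤ μ := fun t ht => by
      rw [hμ, hm]
      exact Real.exp_le_exp.2 (by have := ht.2; gcongr)
    have hQΦ : ‖Φ‖ ^ 2 ≤ Q := by
      rw [L2.norm_sq_eq, hQ, intervalIntegral_eq_setIntegral_Ioo hT.le]
      refine integral_mono_ae (L2.integrable_norm_sq Φ) (hcI hmφ) ?_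
      filter_upwards [coeFn_testToL2 φ, ae_restrict_mem measurableSet_Ioo] with t e1 ht
      rw [e1]
      exact le_mul_of_one_le_left (by positivity) (hm1 t (Ioo_subset_Icc_self ht))
    have hPΦ : ‖P‖ ≤ μ * ‖Φ‖ := by
      refine Lp.norm_le_mul_norm_of_ae_le_mul ?_
      filter_upwards [hPe, coeFn_testToL2 φ, ae_restrict_mem measurableSet_Ioo] with t e1 e2 ht
      rw [e1, e2, norm_smul, Real.norm_of_nonneg (hm0 t).le]
      exact mul_le_mul_of_nonneg_right (hmT t (Ioo_subset_Icc_self ht)) (norm_nonneg _)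
    have hQ0 : 0 ≤ Q := (sq_nonneg _).trans hQΦ
    have hup : RCLike.re (inner 𝕜 P (adjointOp ι a b hT φ)) ≤
        μ * (‖Φ‖ * ‖adjointOp ι a b hT φ‖) := by
      calc _ ≤ ‖P‖ * ‖adjointOp ι a b hT φ‖ := re_inner_le_norm _ _
        _ ≤ μ * ‖Φ‖ * ‖adjointOp ι a b hT φ‖ := by gcongr
        _ = _ := mul_assoc _ _ _
    have h1 := mul_le_mul_of_nonneg_right hrM hQ0
    have h2 := mul_le_mul_of_nonneg_left hQΦ hα.le
    linarith
  refine ⟨2 * μ / α + 2 * μ / √α, by positivity, fun φ => ?_⟩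
  have hk := key φ
  set x := ‖testToL2 𝕜 V T φ‖ with hx
  set s := ‖adjointOp ι a b hT φ‖ with hs
  set z := ‖ι (φ.1 0)‖ with hz
  have hx0 : 0 ≤ x := norm_nonneg _
  have hs0 : 0 ≤ s := norm_nonneg _
  have hz0 : 0 ≤ z := norm_nonneg _
  have hxs : x ≤ 2 * μ / α * s := by
    rcases hx0.eq_or_lt with h0 | h0
    · rw [← h0]; positivity
    · rw [div_mul_eq_mul_div, le_div_iff₀ hα]
      refine le_of_mul_le_mul_right ?_ h0
      nlinarith [sq_nonneg z]
  have hzs : z ≤ 2 * μ / √α * s := by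
    refine abs_le_of_sq_le_sq' ?_ (by positivity) |>.2
    have h1 : z ^ 2 ≤ 2 * (μ * (x * s)) := by nlinarith [sq_nonneg x]
    calc z ^ 2 ≤ 2 * (μ * (x * s)) := h1
      _ ≤ 2 * (μ * (2 * μ / α * s * s)) := by gcongr
      _ = (2 * μ / √α * s) ^ 2 := by
        rw [mul_pow, div_pow, Real.sq_sqrt hα.le]; ring
  have p1 : 0 ≤ 2 * μ / α * s := by positivity
  have p2 : 0 ≤ 2 * μ / √α * s := by positivity
  constructor <;> rw [add_mul] <;> linarith

end Coercivity

/-! ### Existence -/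

section Existence

variable {𝕜 V H : Type*} [RCLike 𝕜]
  [NormedAddCommGroup V] [InnerProductSpace 𝕜 V] [NormedSpace ℝ V] [IsScalarTower ℝ 𝕜 V]
  [NormedAddCommGroup H] [InnerProductSpace 𝕜 H] {T : ℝ}
  [CompleteSpace V] [TopologicalSpace.SeparableSpace V]
  [CompleteSpace H] {ι : V →L[𝕜] H} {a b : NonautonomousForm 𝕜 V T}

/-- Weak solvability of `ẇ + B w + A ∫₀ᵗ w = F`, `w(0) = u₁`: the representation theorem provides
`w`, and `g` is `F - B w - A ∫₀ᵗ w` as an element of `L²(0,T;V')`. -/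
theorem exists_weak_solution (hT : 0 < T) (hb : b.QuasiCoercive ι) (u₁ : H) (F : L2 T V) :
    ∃ (w : L2 T V) (g : L2 T (Antidual 𝕜 V)),
      (g =ᵐ[intervalMeasure T] fun t => rieszAntidual 𝕜 V ((F - memoryOp a b hT w : L2 T V) t)) ∧
      ∀ (ψ : ℝ → ℝ), ContDiff ℝ 1 ψ → ψ T = 0 → ∀ v : V,
        ∫ t in Ioo 0 T, deriv ψ t • embAntidual ι (w t) v =
          -(∫ t in Ioo 0 T, ψ t • g t v) - ψ 0 • inner 𝕜 (ι v) u₁ := by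
  obtain ⟨C, hC0, hC⟩ := exists_norm_le_adjointOp (a := a) hT hb
  let L : testFunctions 𝕜 V T →ₗ[𝕜] 𝕜 :=
    (innerSL 𝕜 F : L2 T V →ₗ[𝕜] 𝕜) ∘ₗ testToL2 𝕜 V T +
      ((innerSL 𝕜 u₁).comp ι : V →ₗ[𝕜] 𝕜) ∘ₗ LinearMap.proj 0 ∘ₗ (testFunctions 𝕜 V T).subtype
  have hL : ∀ φ, L φ = inner 𝕜 F (testToL2 𝕜 V T φ) + inner 𝕜 u₁ (ι (φ.1 0)) := fun φ => rfl
  obtain ⟨w, hw⟩ := exists_inner_eq_of_norm_le (adjointOp ι a b hT) L ((‖F‖ + ‖u₁‖) * C) (by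
    intro φ
    rw [hL]
    calc _ ≤ ‖F‖ * ‖testToL2 𝕜 V T φ‖ + ‖u₁‖ * ‖ι (φ.1 0)‖ :=
          (norm_add_le _ _).trans (add_le_add (norm_inner_le_norm _ _) (norm_inner_le_norm _ _))
      _ ≤ ‖F‖ * (C * ‖adjointOp ι a b hT φ‖) + ‖u₁‖ * (C * ‖adjointOp ι a b hT φ‖) := by
          gcongr
          · exact (hC φ).1
          · exact (hC φ).2
      _ = _ := by ring)
  set G : L2 T V := F - memoryOp a b hT w with hG
  set R : V →L[𝕜] Antidual 𝕜 V :=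
    ((rieszAntidual 𝕜 V).toContinuousLinearEquiv : V →L[𝕜] Antidual 𝕜 V) with hR
  refine ⟨w, R.compLp G, R.coeFn_compLp G, fun ψ hψ hψT v => ?_⟩
  let φ : testFunctions 𝕜 V T := ⟨fun t => ψ t • v, by fun_prop, by simp [hψT]⟩
  have hφd : ∀ t, deriv φ.1 t = deriv ψ t • v := fun t =>
    ((hψ.differentiable one_ne_zero).differentiableAt.hasDerivAt.smul_const v).deriv
  have h1 := hw φ
  rw [inner_adjointOp, hL] at h1
  have h2 : inner 𝕜 (((ContinuousLinearMap.adjoint ι).comp ι).compLp (testDeriv 𝕜 V T φ)) w =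
      -inner 𝕜 (testToL2 𝕜 V T φ) G - inner 𝕜 (ι (φ.1 0)) u₁ := by
    have h3 := congrArg (starRingEnd 𝕜) h1
    simp only [map_sub, map_add, inner_conj_symm] at h3
    rw [hG, inner_sub_right]
    linear_combination -h3
  have h4 : inner 𝕜 (((ContinuousLinearMap.adjoint ι).comp ι).compLp (testDeriv 𝕜 V T φ)) w =
      ∫ t in Ioo 0 T, deriv ψ t • embAntidual ι (w t) v := by
    rw [L2.inner_def]
    refine integral_congr_ae ?_
    filter_upwards [ContinuousLinearMap.coeFn_compLp ((ContinuousLinearMap.adjoint ι).comp ι)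
      (testDeriv 𝕜 V T φ), coeFn_testDeriv φ] with t e1 e2
    rw [e1, e2, hφd, ContinuousLinearMap.comp_apply, ContinuousLinearMap.adjoint_inner_left,
      ← embAntidual_apply ι, map_real_smul (embAntidual ι (w t)) (ContinuousLinearMap.continuous _)]
  have h5 : inner 𝕜 (testToL2 𝕜 V T φ) G = ∫ t in Ioo 0 T, ψ t • R.compLp G t v := by
    rw [L2.inner_def]
    refine integral_congr_ae ?_
    filter_upwards [R.coeFn_compLp G, coeFn_testToL2 φ] with t e1 e2
    rw [e1, e2]
    change inner 𝕜 (ψ t • v) (G t) = ψ t • rieszAntidual 𝕜 V (G t) v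
    rw [← map_real_smul (rieszAntidual 𝕜 V (G t)) (ContinuousLinearMap.continuous _),
      rieszAntidual_apply]
  have h6 : inner 𝕜 (ι (φ.1 0)) u₁ = ψ 0 • inner 𝕜 (ι v) u₁ := by
    change inner 𝕜 (ι (ψ 0 • v)) u₁ = _
    rw [← toAntidual_apply, ← toAntidual_apply,
      map_real_smul (toAntidual ι u₁) (ContinuousLinearMap.continuous _)]
  rw [← h4, h2, h5, h6]

theorem exists_isSolution (hι_dense : DenseRange ι) (hT : 0 < T) (hb : b.QuasiCoercive ι) (u₀ : V)
    (u₁ : H) (f : L2 T (Antidual 𝕜 V)) : ∃ u : L2 T V, IsSolution ι a b u₀ u₁ f u := by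
  set c : L2 T V := (memLp_const u₀ : MemLp (fun _ : ℝ => u₀) 2 (intervalMeasure T)).toLp _ with hc
  have hce : c =ᵐ[intervalMeasure T] fun _ => u₀ := MemLp.coeFn_toLp _
  set Rinv : Antidual 𝕜 V →L[𝕜] V :=
    ((rieszAntidual 𝕜 V).symm.toContinuousLinearEquiv : Antidual 𝕜 V →L[𝕜] V) with hRinv
  obtain ⟨w, g, hg, hwg⟩ := exists_weak_solution (a := a) hT hb u₁ (Rinv.compLp f - a.opL2 c)
  set u : L2 T V := c + volterra V 𝕜 hT w with hu
  have hue : u =ᵐ[intervalMeasure T] fun t => u₀ + ∫ s in (0 : ℝ)..t, w s := by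
    filter_upwards [Lp.coeFn_add c (volterra V 𝕜 hT w), hce, coeFn_volterra 𝕜 hT w]
      with t h1 h2 h3
    rw [h1, Pi.add_apply, h2, h3]
  have huw : IsWeakDeriv u w := isWeakDeriv_of_ae_eq_primitive hT hue
  have hembu := huw.compLp (embAntidual ι)
  have hembw : IsWeakDeriv ((embAntidual ι).compLp w) g := by
    intro ψ hψ hψc hψs
    have hψ1 : ContDiff ℝ 1 ψ := hψ.of_le (by exact_mod_cast le_top)
    have hvan : ∀ t ∉ Ioo 0 T, ψ t = 0 := fun t ht => by
      by_contra hne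
      exact ht (hψs (subset_tsupport ψ hne))
    have heval : ∀ (χ : ℝ → ℝ), Continuous χ → HasCompactSupport χ →
        ∀ (k : L2 T (Antidual 𝕜 V)) (v : V),
          (∫ t in Ioo 0 T, χ t • k t) v = ∫ t in Ioo 0 T, χ t • k t v := by
      intro χ hχ hχc k v
      exact ((ContinuousLinearMap.apply' 𝕜 (starRingEnd 𝕜) v).integral_comp_comm
        (L2.integrable_smul hχ hχc k)).symm
    ext v
    rw [heval _ (hψ1.continuous_deriv le_rfl) hψc.deriv, neg_apply, heval _ hψ.continuous hψc]
    have h1 := hwg ψ hψ1 (hvan T (by simp)) v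
    rw [hvan 0 (by simp), zero_smul, sub_zero] at h1
    rw [← h1]
    refine integral_congr_ae ?_
    filter_upwards [(embAntidual ι).coeFn_compLp w] with t ht
    rw [ht]
  obtain ⟨q, hqc, hqw, -, hqv⟩ := exists_continuousOn_representative ι hT hembw
  -- Testing with `t ↦ (T - t) v` identifies the initial value.
  have hq0 : q 0 = u₁ := by
    have h1 : ∀ v : V, inner 𝕜 (ι v) (q 0) = inner 𝕜 (ι v) u₁ := by
      intro v
      have h2 := hwg (fun t => T - t) (by fun_prop) (sub_self T) v
      have h3 : ∀ t : ℝ, deriv (fun t => T - t) t = -1 := fun t => by simp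
      simp only [h3, neg_smul, one_smul, integral_neg, sub_zero] at h2
      have h4 := hqv v
      have h5 : ∀ t, g t ((T - t) • v) = (T - t) • g t v := fun t =>
        map_real_smul (g t) (ContinuousLinearMap.continuous _) _ _
      simp only [h5, intervalIntegral_eq_setIntegral_Ioo hT.le] at h4
      have h6 : T • inner 𝕜 (ι v) (q 0) = T • inner 𝕜 (ι v) u₁ := by
        rw [h4] at h2
        simp only [neg_sub] at h2
        have h7 : ∀ x y z : 𝕜, -x = y - x - z → y = z := fun x y z h => by linear_combination -h
        exact h7 _ _ _ h2
      exact smul_right_injective 𝕜 hT.ne' h6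
    refine ext_inner_left 𝕜 fun x => ?_
    exact hι_dense.induction_on x (isClosed_eq (by fun_prop) (by fun_prop)) h1
  have e1 : weakDeriv u = w := huw.weakDeriv_eq
  have e2 : weakDeriv ((embAntidual ι).compLp u) = (embAntidual ι).compLp w := hembu.weakDeriv_eq
  have e3 : weakDeriv ((embAntidual ι).compLp w) = g := hembw.weakDeriv_eq
  refine ⟨u, ⟨⟨w, huw⟩, ⟨_, hembu⟩, ?_⟩, ?_, ?_, ?_⟩
  · rw [e2]; exact ⟨g, hembw⟩
  · rw [e2, e3, e1]
    filter_upwards [hg, Lp.coeFn_sub (Rinv.compLp f - a.opL2 c) (memoryOp a b hT w),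
      Lp.coeFn_sub (Rinv.compLp f) (a.opL2 c), Rinv.coeFn_compLp f, a.coeFn_opL2 c,
      Lp.coeFn_add (b.opL2 w) (a.opL2 (volterra V 𝕜 hT w)), b.coeFn_opL2 w,
      a.coeFn_opL2 (volterra V 𝕜 hT w), Lp.coeFn_add c (volterra V 𝕜 hT w)]
      with t p1 p2 p3 p4 p5 p6 p7 p8 p9 ht
    have p10 : memoryOp a b hT w t = b.repr t (w t) + a.repr t (volterra V 𝕜 hT w t) := by
      rw [← p7, ← p8]; exact p6
    have p11 : rieszAntidual 𝕜 V (Rinv (f t)) = f t := (rieszAntidual 𝕜 V).apply_symm_apply _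
    rw [p1, p2, Pi.sub_apply, p3, Pi.sub_apply, p4, p5, p10, hu, p9, Pi.add_apply, map_sub, map_sub,
      map_add, p11, a.riesz_repr ht, a.riesz_repr ht, b.riesz_repr ht, map_add]
    abel
  · refine ⟨fun t => u₀ + ∫ s in (0 : ℝ)..t, w s, continuousOn_const.add
      (continuousOn_primitive_of_integrableOn hT (integrableOn_of_memLp_two (Lp.memLp w))), hue, ?_⟩
    simp
  · rw [e1]
    exact ⟨q, hqc, hqw, hq0⟩

end Existence

end DampedWave

end

theorem mainTheorem1 {𝕜 V H : Type*} [RCLike 𝕜]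
    [NormedAddCommGroup V] [InnerProductSpace 𝕜 V] [CompleteSpace V]
    [TopologicalSpace.SeparableSpace V]
    [NormedSpace ℝ V] [IsScalarTower ℝ 𝕜 V]
    [NormedAddCommGroup H] [InnerProductSpace 𝕜 H] [CompleteSpace H]
    [TopologicalSpace.SeparableSpace H]
    (ι : V →L[𝕜] H) (hι_inj : Function.Injective ι) (hι_dense : DenseRange ι)
    (T : ℝ) (hT : 0 < T)
    (a b : DampedWave.NonautonomousForm 𝕜 V T)
    (ha : a.QuasiCoercive ι) (hb : b.QuasiCoercive ι) :
    (∀ (u₀ : V) (u₁ : H) (f : DampedWave.L2 T (DampedWave.Antidual 𝕜 V)),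
      ∃! u : DampedWave.L2 T V, DampedWave.IsSolution ι a b u₀ u₁ f u) ∧
    ∃ C : ℝ, 0 < C ∧
      ∀ (u₀ : V) (u₁ : H) (f : DampedWave.L2 T (DampedWave.Antidual 𝕜 V)) (u : DampedWave.L2 T V),
        DampedWave.IsSolution ι a b u₀ u₁ f u →
          DampedWave.normMR ι u ≤ C * (‖u₀‖ + ‖u₁‖ + ‖f‖) := by
  refine ⟨fun u₀ u₁ f => ?_, DampedWave.exists_normMR_le hT hb⟩
  obtain ⟨u, hu⟩ := DampedWave.exists_isSolution (a := a) hι_dense hT hb u₀ u₁ f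
  exact ⟨u, hu, fun v hv => hv.unique hT hb hu⟩
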